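/- Let $G$ be a finitely generated abelian group (with the discrete topology) and $\phi:G\to G$ an endomorphism. Let $R(\phi)\in\{1,2,\dots,\infty\}$ be the number of $\phi$-conjugacy classes of $G$, where $\alpha,\alpha'\in G$ are $\phi$-conjugate if $\alpha'=\gamma\alpha\phi(\gamma)^{-1}$ for some $\gamma\in G$. Let $\hat G$ be the Pontryagin dual of $G$, with its compact-open topology, and let $\hat\phi:\hat G\to\hat G$, $\hat\phi(\chi)=\chi\circ\phi$, be the dual endomorphism. For a continuous self-map $f$ of $\hat G$ let $L(f)=\sum_{k\ge 0}(-1)^k\,\mathrm{Tr}\big(f_*:H_k(\hat G;\mathbb Q)\to H_k(\hat G;\mathbb Q)\big)$ be its Lefschetz number, where $H_k$ is singular homology; this is well defined, since every $H_k(\hat G;\mathbb Q)$ is finite-dimensional and $H_k(\hat G;\mathbb Q)=0$ for $k>\mathrm{rank}\,G$. (1) For every $n\ge 1$ with $R(\phi^n)<\infty$, $$R(\phi^n)=|L(\hat\phi^{\,n})|.$$ (2) Suppose that $R(\phi^n)<\infty$ for all $n\ge 1$, and consider the formal power series $$R_\phi(z)=\exp\Big(\sum_{n\ge 1}\frac{R(\phi^n)}{n}z^n\Big),\qquad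 L_{\hat\phi}(z)=\exp\Big(\sum_{n\ge 1}\frac{L(\hat\phi^{\,n})}{n}z^n\Big).$$ Let $\phi^\infty$ be the endomorphism induced by $\phi$ on the quotient $G^\infty$ of $G$ by its torsion subgroup, let $r$ be the number of real eigenvalues $\lambda$ of $\phi^\infty$ with $|\lambda|>1$, let $p$ be the number of real eigenvalues $\lambda$ of $\phi^\infty$ with $\lambda<-1$ (both counted with algebraic multiplicity), and let $\sigma=(-1)^p$. Then $$R_\phi(z)=L_{\hat\phi}(\sigma z)^{(-1)^r}.$$ (3) If $G$ is finite, then $R(\phi^n)<\infty$ and $R(\phi^n)=L(\hat\phi^{\,n})$ for all $n\ge 1$, and $R_\phi(z)=L_{\hat\phi}(z)$. -/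

import Mathlib

open CategoryTheory

universe u

noncomputable section

namespace Reidemeister

/-! ### Reidemeister numbers -/

/-- `φ`-conjugacy: `α` and `α'` are `φ`-conjugate if `α' = γ α φ(γ)⁻¹` for some `γ`. -/
def twistedConjSetoid {G : Type u} [Group G] (φ : Monoid.End G) : Setoid G where
  r α α' := ∃ γ : G, α' = γ * α * (φ γ)⁻¹
  iseqv :=
    { refl := fun α => ⟨1, by simp⟩
      symm := by
        rintro α α' ⟨γ, rfl⟩
        exact ⟨γ⁻¹, by simp [mul_assoc]⟩
      trans := by
        rintro α β δ ⟨γ, rfl⟩ ⟨γ', rfl⟩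
        exact ⟨γ' * γ, by simp [mul_assoc]⟩ }

/-- The Reidemeister number `R(φ)`: the number of `φ`-conjugacy classes, possibly infinite. -/
def reidemeisterNumber {G : Type u} [Group G] (φ : Monoid.End G) : ℕ∞ :=
  ENat.card (Quotient (twistedConjSetoid φ))

/-! ### Lefschetz numbers -/

/-- The singular homology `H_k(X; ℚ)`. -/
def rationalHomology (k : ℕ) (X : Type u) [TopologicalSpace X] : ModuleCat.{u} ℚ :=
  ((AlgebraicTopology.singularHomologyFunctor (ModuleCat.{u} ℚ) k).obj
    (ModuleCat.of ℚ (ULift.{u} ℚ))).obj (TopCat.of X)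

/-- The map induced on `H_k(X; ℚ)` by a continuous self-map of `X`. -/
def rationalHomologyMap (k : ℕ) {X : Type u} [TopologicalSpace X] (f : C(X, X)) :
    rationalHomology k X →ₗ[ℚ] rationalHomology k X :=
  (((AlgebraicTopology.singularHomologyFunctor (ModuleCat.{u} ℚ) k).obj
    (ModuleCat.of ℚ (ULift.{u} ℚ))).map (TopCat.ofHom f)).hom

/-- The Lefschetz number `L(f) = ∑ₖ (-1)ᵏ Tr (f_* : H_k(X; ℚ) → H_k(X; ℚ))`, for spaces whose
rational homology is finite-dimensional and vanishes in all large degrees. -/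
def lefschetzNumber {X : Type u} [TopologicalSpace X] (f : C(X, X)) : ℚ :=
  ∑ᶠ k : ℕ, (-1) ^ k * LinearMap.trace ℚ (rationalHomology k X) (rationalHomologyMap k f)

/-- The `n`-th iterate of a continuous self-map. -/
def iterateMap {X : Type u} [TopologicalSpace X] (f : C(X, X)) (n : ℕ) : C(X, X) :=
  ⟨f^[n], f.continuous.iterate n⟩

/-! ### Zeta functions as formal power series -/

/-- The zeta function `exp (∑_{n ≥ 1} aₙ zⁿ / n)` of a sequence `(aₙ)_{n ≥ 1}`. -/
def zetaSeries (a : ℕ → ℚ) : PowerSeries ℚ :=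
  (PowerSeries.exp ℚ).subst (PowerSeries.mk fun n => if n = 0 then 0 else a n / n)

/-- The Reidemeister zeta function `R_φ(z)`, for `φ` such that `R(φⁿ) < ∞` for all `n ≥ 1`. -/
def reidemeisterZeta {G : Type u} [Group G] (φ : Monoid.End G) : PowerSeries ℚ :=
  zetaSeries fun n => ((reidemeisterNumber (φ ^ n)).toNat : ℚ)

/-- The Lefschetz zeta function `L_f(z)`. -/
def lefschetzZeta {X : Type u} [TopologicalSpace X] (f : C(X, X)) : PowerSeries ℚ :=
  zetaSeries fun n => lefschetzNumber (iterateMap f n)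

/-- `F ^ ((-1) ^ r)` for a power series `F` with non-zero constant term. -/
def signPow (F : PowerSeries ℚ) (r : ℕ) : PowerSeries ℚ :=
  if Even r then F else F⁻¹

/-! ### The dual endomorphism -/

/-- The dual map `χ ↦ χ ∘ φ` on the Pontryagin dual of a discrete group, as a self-map of the
topological space underlying the dual. -/
def dualMap {G : Type u} [CommGroup G] [TopologicalSpace G] [DiscreteTopology G]
    (φ : Monoid.End G) : C(PontryaginDual G, PontryaginDual G) :=
  ⟨PontryaginDual.map (⟨φ, continuous_of_discreteTopology⟩ : G →ₜ* G),
    (PontryaginDual.map (⟨φ, continuous_of_discreteTopology⟩ : G →ₜ* G)).continuous_toFun⟩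

/-! ### The torsion-free quotient and the constants `p`, `r`, `σ` -/

/-- The quotient of `G` by its torsion subgroup, written additively. -/
abbrev FreePart (G : Type u) [CommGroup G] : Type u :=
  Additive (G ⧸ CommGroup.torsion G)

instance freePart_finite (G : Type u) [CommGroup G] [Group.FG G] :
    Module.Finite ℤ (FreePart G) :=
  Module.Finite.iff_addGroup_fg.2 inferInstance

instance freePart_free (G : Type u) [CommGroup G] [Group.FG G] :
    Module.Free ℤ (FreePart G) :=
  inferInstance

/-- The endomorphism of the torsion-free quotient induced by an endomorphism of `G`. -/
def freePartMap {G : Type u} [CommGroup G] (φ : Monoid.End G) : FreePart G →ₗ[ℤ] FreePart G :=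
  (MonoidHom.toAdditive (QuotientGroup.map (CommGroup.torsion G) (CommGroup.torsion G)
    (φ : G →* G) (fun _ hx => MonoidHom.isOfFinOrder (φ : G →* G) hx))).toIntLinearMap

/-- The real eigenvalues, with algebraic multiplicity, of the endomorphism induced by `φ` on the
torsion-free quotient of `G`. -/
def realSpectrum {G : Type u} [CommGroup G] [Group.FG G] (φ : Monoid.End G) : Multiset ℝ :=
  ((freePartMap φ).charpoly.map (Int.castRingHom ℝ)).roots

open scoped Classical in
/-- `p`: the number of real eigenvalues `< -1`. -/
def numLtNegOne {G : Type u} [CommGroup G] [Group.FG G] (φ : Monoid.End G) : ℕ :=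
  (realSpectrum φ).countP fun x => x < -1

open scoped Classical in
/-- `r`: the number of real eigenvalues of absolute value `> 1`. -/
def numAbsGtOne {G : Type u} [CommGroup G] [Group.FG G] (φ : Monoid.End G) : ℕ :=
  (realSpectrum φ).countP fun x => 1 < |x|

/-- `σ = (-1) ^ p`. -/
def sigma {G : Type u} [CommGroup G] [Group.FG G] (φ : Monoid.End G) : ℚ :=
  (-1) ^ numLtNegOne φ

end Reidemeister

end

noncomputable section

namespace Reidemeister

/-! ### Lifting maps to the circle -/

section Lifting

variable {A : Type*} [TopologicalSpace A]

/-! Let `T` be the torsion subgroup and `A` the endomorphism induced on `G / T`. Both `R(φ)` and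
`|L(φ̂)|` equal `#Fix(dual of φ|T) · |det(1 - A)|` as soon as `det(1 - A) ≠ 0`, and finiteness of
`R(φ)` forces this.

Algebra: for abelian `G` the classes are the cosets of the image of `x ↦ x φ(x)⁻¹`. Its index is the
product of the index in `T` and the index `|det(1 - A)|` in the free quotient; by injectivity of `1
- A` the factor in `T` is the order of the coinvariants of `φ|T`, whose characters are the fixed
points of the dual (`toNat_reidemeisterNumber_eq_mul`).

Topology: the dual of `G` is a torus times a finite discrete set. The map `φ̂` permutes the
components through the dual of `φ|T`, and on each one it is a matrix map up to translation, so
`L(φ̂)` is a number of fixed points times `L` of that matrix map (`lefschetzNumber_dualMap`).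

On a torus, `L` equals `det(1 - A)` (`lefschetzNumber_matrixMap`). For diagonal matrices this
follows by adding one circle at a time, through the exact sequence of the infinite cyclic covering
`X × ℝ → X × Circle`. In general `L` is a polynomial in the entries of `A` and invariant under `AB ↦
BA`; such a function is determined by its values on diagonal integer matrices. This avoids computing
the homology ring of the torus.

Zeta functions: conjugate pairs of non-real eigenvalues contribute squares of absolute values to
`det(1 - Aⁿ)`, so only real eigenvalues affect its sign, which is `(-1)^(r + pn)`. In the
exponential, `(-1)^(pn)` becomes the substitution `z ↦ σz` and `(-1)^r` becomes an exponent. -/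

theorem exists_circle_lift [ContractibleSpace A] (f : C(A, Circle)) :
    ∃ F : C(A, ℝ), ∀ a, Circle.exp (F a) = f a := by
  obtain ⟨a₀, ⟨H⟩⟩ := id_nullhomotopic A
  obtain ⟨e₀, he₀⟩ : ∃ x, Circle.exp x = f a₀ := ⟨_, Circle.exp_arg _⟩
  -- The reversed contraction makes `K` a homotopy from the constant `f a₀` to `f`. The constant
  -- lifts to `e₀`; the end of the lifted homotopy lifts `f`.
  let K : C(unitInterval × A, Circle) := f.comp H.symm.toContinuousMap
  have hK : ∀ a, K (0, a) = Circle.exp ((ContinuousMap.const A e₀) a) := by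
    intro a
    have h := H.symm.apply_zero a
    simp only [ContinuousMap.const_apply] at h ⊢
    rw [he₀, ← h]
    rfl
  refine ⟨⟨fun a => Circle.isCoveringMap_exp.liftHomotopy K (ContinuousMap.const A e₀) hK (1, a),
    by fun_prop⟩, fun a => ?_⟩
  have h := congrFun (Circle.isCoveringMap_exp.liftHomotopy_lifts K (ContinuousMap.const A e₀) hK)
    (1, a)
  refine h.trans ?_
  have h1 := H.symm.apply_one a
  exact congrArg f h1

/-- Choose `m` to match the two lifts at one point; uniqueness of lifts on a connected space does
the rest. -/
theorem exists_int_of_circleExp_eq [PreconnectedSpace A] [Nonempty A] (F F' : C(A, ℝ))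
    (h : ∀ a, Circle.exp (F a) = Circle.exp (F' a)) :
    ∃ m : ℤ, ∀ a, F' a = F a + 2 * Real.pi * m := by
  obtain ⟨a₀⟩ := ‹Nonempty A›
  obtain ⟨m, hm⟩ := Circle.exp_eq_exp.1 (h a₀).symm
  refine ⟨m, fun a => ?_⟩
  have hexp : ∀ a, Circle.exp (F a + 2 * Real.pi * m) = Circle.exp (F' a) := fun a => by
    rw [← h a, Circle.exp_eq_exp]
    exact ⟨m, by ring⟩
  have := Circle.isCoveringMap_exp.eq_of_comp_eq (g₁ := fun a => F' a)
    (g₂ := fun a => F a + 2 * Real.pi * m) (by fun_prop) (by fun_prop)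
    (funext fun a => (hexp a).symm) a₀ (by simp only [hm]; ring)
  exact congrFun this a

variable (X : Type*) [TopologicalSpace X]

/-- The lift to `X × ℝ`, with a prescribed number of additional turns, of a map to `X × Circle`. -/
def liftTurns [ContractibleSpace A] (f : C(A, X × Circle) × ℤ) : C(A, X × ℝ) :=
  ⟨fun a => ((f.1 a).1, Classical.choose (exists_circle_lift
      (⟨fun a => (f.1 a).2, by fun_prop⟩ : C(A, Circle))) a + 2 * Real.pi * f.2), by fun_prop⟩

theorem liftTurns_spec [ContractibleSpace A] (f : C(A, X × Circle) × ℤ) (a : A) :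
    ((liftTurns X f a).1, Circle.exp (liftTurns X f a).2) = f.1 a := by
  have h := Classical.choose_spec (exists_circle_lift
      (⟨fun a => (f.1 a).2, by fun_prop⟩ : C(A, Circle))) a
  refine Prod.ext rfl ?_
  refine Eq.trans ?_ h
  rw [Circle.exp_eq_exp]
  exact ⟨f.2, by simp only [liftTurns, ContinuousMap.coe_mk]; ring⟩

theorem liftTurns_bijective [ContractibleSpace A] :
    Function.Bijective (liftTurns X (A := A)) := by
  obtain ⟨a₀⟩ : Nonempty A := inferInstance
  constructor
  · rintro ⟨f, m⟩ ⟨g, n⟩ h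
    have hfg : f = g := by
      ext1 a
      rw [← liftTurns_spec X (f, m) a, h, liftTurns_spec]
    subst hfg
    have := congrArg Prod.snd (DFunLike.congr_fun h a₀)
    simp only [liftTurns, ContinuousMap.coe_mk, add_right_inj] at this
    have hmn : (m : ℝ) = n := by
      have hpi := Real.pi_pos
      exact mul_left_cancel₀ (by positivity) this
    rw [Int.cast_injective hmn]
  · intro F
    let f : C(A, X × Circle) := ⟨fun a => ((F a).1, Circle.exp (F a).2), by fun_prop⟩
    have h0 := liftTurns_spec X (f, 0)
    obtain ⟨m, hm⟩ := exists_int_of_circleExp_eq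
      (⟨fun a => (liftTurns X (f, 0) a).2, by fun_prop⟩ : C(A, ℝ))
      (⟨fun a => (F a).2, by fun_prop⟩ : C(A, ℝ)) fun a => congrArg Prod.snd (h0 a)
    refine ⟨(f, m), ?_⟩
    ext1 a
    refine Prod.ext rfl ?_
    have := hm a
    simp only [liftTurns, ContinuousMap.coe_mk, Int.cast_zero, mul_zero, add_zero] at this ⊢
    exact this.symm

/-- Maps to `X × ℝ` are maps to `X × Circle` together with an integer. -/
def liftEquiv [ContractibleSpace A] : C(A, X × ℝ) ≃ C(A, X × Circle) × ℤ :=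
  (Equiv.ofBijective _ (liftTurns_bijective X)).symm

theorem liftEquiv_fst [ContractibleSpace A] (F : C(A, X × ℝ)) (a : A) :
    (liftEquiv X F).1 a = ((F a).1, Circle.exp (F a).2) := by
  obtain ⟨f, rfl⟩ := (Equiv.ofBijective _ (liftTurns_bijective X)).surjective F
  rw [liftEquiv, Equiv.symm_apply_apply]
  exact (liftTurns_spec X f a).symm

theorem liftEquiv_shift [ContractibleSpace A] (F F' : C(A, X × ℝ))
    (h : ∀ a, F' a = ((F a).1, (F a).2 + 2 * Real.pi)) :
    liftEquiv X F' = ((liftEquiv X F).1, (liftEquiv X F).2 + 1) := by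
  obtain ⟨f, rfl⟩ := (Equiv.ofBijective _ (liftTurns_bijective X)).surjective F
  rw [liftEquiv, Equiv.symm_apply_apply, Equiv.symm_apply_eq]
  ext1 a
  rw [h]
  simp only [Equiv.ofBijective_apply, liftTurns, ContinuousMap.coe_mk, Prod.mk.injEq, true_and]
  push_cast
  ring

end Lifting

/-! ### Sums over integer intervals -/

section IntSum

variable {M N : Type*} [AddCommGroup M] [AddCommGroup N]

/-- The signed sum `∑_{0 ≤ j < m} u j`, equal to `-∑_{m ≤ j < 0} u j` for negative `m`. -/
def intSum (u : ℤ → M) : ℤ → M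
  | Int.ofNat n => ∑ j ∈ Finset.range n, u j
  | Int.negSucc n => -∑ j ∈ Finset.range (n + 1), u (Int.negSucc j)

theorem intSum_zero (u : ℤ → M) : intSum u 0 = 0 := rfl

theorem intSum_add_one (u : ℤ → M) (m : ℤ) : intSum u (m + 1) = intSum u m + u m := by
  cases m with
  | ofNat n => exact Finset.sum_range_succ _ _
  | negSucc n =>
    cases n with
    | zero =>
      change (0 : M) = _
      simp [intSum]
    | succ n =>
      have h : Int.negSucc (n + 1) + 1 = Int.negSucc n := by omega
      rw [h]
      simp only [intSum]
      rw [Finset.sum_range_succ _ (n + 1)]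
      abel

/-- The one-step recurrence can be run in both directions, so identities for signed sums reduce to
it without a case split on the sign. -/
theorem intSum_unique (u v : ℤ → M) (h0 : v 0 = 0) (h : ∀ m, v (m + 1) = v m + u m) (m : ℤ) :
    intSum u m = v m := by
  induction m using Int.induction_on with
  | zero => rw [intSum_zero, h0]
  | succ m ih => rw [intSum_add_one, h, ih]
  | pred m ih =>
    have h1 := intSum_add_one u (-(m : ℤ) - 1)
    have h2 := h (-(m : ℤ) - 1)
    rw [sub_add_cancel] at h1 h2
    rw [ih, h2] at h1
    exact (add_right_cancel h1).symm

theorem intSum_telescope (u : ℤ → M) (m : ℤ) :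
    intSum (fun j => u (j + 1) - u j) m = u m - u 0 :=
  intSum_unique _ (fun m => u m - u 0) (sub_self _) (fun _ => by abel) m

theorem intSum_const (c : M) (m : ℤ) : intSum (fun _ => c) m = m • c :=
  intSum_unique _ (fun m => m • c) (zero_smul _ _) (fun _ => by rw [add_smul, one_smul]) m

theorem map_intSum (f : M →+ N) (u : ℤ → M) (m : ℤ) :
    f (intSum u m) = intSum (fun j => f (u j)) m :=
  (intSum_unique _ (fun m => f (intSum u m)) (by rw [intSum_zero, map_zero])
    (fun m => by rw [intSum_add_one, map_add]) m).symm

end IntSum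

/-! ### The exact sequence of an infinite cyclic covering of simplicial sets -/

section Covering

open Simplicial Limits

variable {C : Type*} [Category* C] [Preadditive C] [HasCoproducts.{u} C] (R : C)
  {E B : SSet.{u}} (p : E ⟶ B) (t : E ⟶ E)
  (e : ∀ n : ℕ, E _⦋n⦌ ≃ B _⦋n⦌ × ℤ)

/-- The morphism out of the `n`-chains of a simplicial set given by its values on simplices. -/
def chainDesc {T : C} (K : SSet.{u}) {n : ℕ} (f : K _⦋n⦌ → (R ⟶ T)) : (K.chainComplex R).X n ⟶ T :=
  Cofan.IsColimit.desc (K.isColimitChainComplexXCofan R n) f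

@[simp]
theorem ι_chainDesc {T : C} (K : SSet.{u}) {n : ℕ} (f : K _⦋n⦌ → (R ⟶ T)) (x : K _⦋n⦌) :
    K.ιChainComplex x ≫ chainDesc R K f = f x :=
  Cofan.IsColimit.fac (K.isColimitChainComplexXCofan R n) f x

/-- The complex `C(E) → C(E) → C(B)`, with first map `t - 1`, of a projection `p : E → B`
and an automorphism `t` over `B`. -/
def coveringShortComplex (hpt : t ≫ p = p) : ShortComplex (ChainComplex C ℕ) where
  X₁ := E.chainComplex R
  X₂ := E.chainComplex R
  X₃ := B.chainComplex R
  f := SSet.chainComplexMap t R - 𝟙 _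
  g := SSet.chainComplexMap p R
  zero := by
    rw [Preadditive.sub_comp, ← Functor.map_comp, hpt, Category.id_comp, sub_self]

/-- The retraction of `t - 1` in degree `n`. -/
def coveringRetraction (n : ℕ) : (E.chainComplex R).X n ⟶ (E.chainComplex R).X n :=
  chainDesc R E fun x => intSum (fun j => E.ιChainComplex ((e n).symm ((e n x).1, j))) (e n x).2

/-- The section of `p` in degree `n`. -/
def coveringSection (n : ℕ) : (B.chainComplex R).X n ⟶ (E.chainComplex R).X n :=
  chainDesc R B fun y => E.ιChainComplex ((e n).symm (y, 0))

theorem coveringSection_comp (hp : ∀ n x, p.app (.op ⦋n⦌) x = (e n x).1) (n : ℕ) :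
    coveringSection R e n ≫ (SSet.chainComplexMap p R).f n = 𝟙 _ := by
  refine SSet.chainComplex_hom_ext fun y => ?_
  rw [← Category.assoc, coveringSection, ι_chainDesc, SSet.ι_chainComplexMap_f, hp,
    Equiv.apply_symm_apply, Category.comp_id]

/-- The signed sums attached to `t x` and to `x` differ by one term, and this term is `x` itself. -/
theorem comp_coveringRetraction
    (ht : ∀ n x, e n (t.app (.op ⦋n⦌) x) = ((e n x).1, (e n x).2 + 1)) (n : ℕ) :
    (SSet.chainComplexMap t R - 𝟙 _).f n ≫ coveringRetraction R e n = 𝟙 _ := by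
  refine SSet.chainComplex_hom_ext fun x => ?_
  rw [HomologicalComplex.sub_f_apply, HomologicalComplex.id_f, Preadditive.sub_comp,
    Preadditive.comp_sub, SSet.ι_chainComplexMap_f_assoc,
    Category.id_comp, coveringRetraction, ι_chainDesc, ι_chainDesc, ht, intSum_add_one,
    add_sub_cancel_left]
  change E.ιChainComplex ((e n).symm (e n x)) = _
  rw [Equiv.symm_apply_apply, Category.comp_id]

/-- For `x = (y, m)`, applying `t - 1` to the signed sum of the `(y, j)` telescopes to `(y, m) - (y,
0)`, and the section of `p` restores `(y, 0)`. -/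
theorem coveringRetraction_comp_add (hp : ∀ n x, p.app (.op ⦋n⦌) x = (e n x).1)
    (ht : ∀ n x, e n (t.app (.op ⦋n⦌) x) = ((e n x).1, (e n x).2 + 1)) (n : ℕ) :
    coveringRetraction R e n ≫ (SSet.chainComplexMap t R - 𝟙 _).f n +
      (SSet.chainComplexMap p R).f n ≫ coveringSection R e n = 𝟙 _ := by
  refine SSet.chainComplex_hom_ext fun x => ?_
  rw [Preadditive.comp_add, ← Category.assoc, coveringRetraction, ι_chainDesc,
    SSet.ι_chainComplexMap_f_assoc, coveringSection, ι_chainDesc, hp, Category.comp_id]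
  have h := map_intSum (Preadditive.rightComp R ((SSet.chainComplexMap t R - 𝟙 _).f n))
    (fun j => E.ιChainComplex ((e n).symm ((e n x).1, j))) (e n x).2
  change intSum _ _ ≫ _ = intSum (fun j => _ ≫ _) _ at h
  have hj : ∀ j, E.ιChainComplex (R := R) ((e n).symm ((e n x).1, j)) ≫
      (SSet.chainComplexMap t R - 𝟙 _).f n =
      E.ιChainComplex ((e n).symm ((e n x).1, j + 1)) -
      E.ιChainComplex ((e n).symm ((e n x).1, j)) := fun j => by
    rw [HomologicalComplex.sub_f_apply, HomologicalComplex.id_f, Preadditive.comp_sub,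
      SSet.ι_chainComplexMap_f, Category.comp_id]
    congr 2
    rw [Equiv.eq_symm_apply, ht, Equiv.apply_symm_apply]
  simp only [hj] at h
  rw [intSum_telescope (fun j => E.ιChainComplex ((e n).symm ((e n x).1, j)))] at h
  rw [h, Prod.mk.eta, Equiv.symm_apply_apply, sub_add_cancel]

/-- If `t` generates a free action of `ℤ` on `E` with quotient `B`, the complex
`C(E) → C(E) → C(B)` splits in each degree. -/
def coveringSplitting (hpt : t ≫ p = p) (hp : ∀ n x, p.app (.op ⦋n⦌) x = (e n x).1)
    (ht : ∀ n x, e n (t.app (.op ⦋n⦌) x) = ((e n x).1, (e n x).2 + 1)) (n : ℕ) :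
    ((coveringShortComplex R p t hpt).map (HomologicalComplex.eval C _ n)).Splitting where
  r := coveringRetraction R e n
  s := coveringSection R e n
  f_r := comp_coveringRetraction R t e ht n
  s_g := coveringSection_comp R p e hp n
  id := coveringRetraction_comp_add R p t e hp ht n

end Covering

/-! ### Functoriality and homotopy invariance of rational homology -/

section Homology

variable {X Y Z : Type u} [TopologicalSpace X] [TopologicalSpace Y] [TopologicalSpace Z]

/-- The rational singular chain complex. -/
abbrev rationalChains (X : Type u) [TopologicalSpace X] : ChainComplex (ModuleCat.{u} ℚ) ℕ :=
  (TopCat.toSSet.obj (TopCat.of X)).chainComplex (ModuleCat.of ℚ (ULift.{u} ℚ))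

/-- The chain map induced by a continuous map. -/
abbrev rationalChainsMap (f : C(X, Y)) : rationalChains X ⟶ rationalChains Y :=
  SSet.chainComplexMap (TopCat.toSSet.map (TopCat.ofHom f)) (ModuleCat.of ℚ (ULift.{u} ℚ))

/-- The map induced on rational homology by a continuous map. -/
def hmap (k : ℕ) (f : C(X, Y)) : rationalHomology k X →ₗ[ℚ] rationalHomology k Y :=
  (HomologicalComplex.homologyMap (rationalChainsMap f) k).hom

theorem rationalHomologyMap_eq_hmap (k : ℕ) (f : C(X, X)) : rationalHomologyMap k f = hmap k f :=
  rfl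

theorem hmap_id (k : ℕ) : hmap k (ContinuousMap.id X) = LinearMap.id := by
  have h : rationalChainsMap (ContinuousMap.id X) = 𝟙 _ := by
    change ((SSet.chainComplexFunctor _).obj _).map (TopCat.toSSet.map (𝟙 _)) = _
    rw [CategoryTheory.Functor.map_id, CategoryTheory.Functor.map_id]
  rw [hmap, h, HomologicalComplex.homologyMap_id]
  rfl

theorem rationalChainsMap_comp (g : C(Y, Z)) (f : C(X, Y)) :
    rationalChainsMap (g.comp f) = rationalChainsMap f ≫ rationalChainsMap g := by
  change ((SSet.chainComplexFunctor _).obj _).map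
    (TopCat.toSSet.map (TopCat.ofHom f ≫ TopCat.ofHom g)) = _
  rw [Functor.map_comp, Functor.map_comp]

theorem hmap_comp (k : ℕ) (g : C(Y, Z)) (f : C(X, Y)) :
    hmap k (g.comp f) = hmap k g ∘ₗ hmap k f := by
  rw [hmap, rationalChainsMap_comp, HomologicalComplex.homologyMap_comp]
  rfl

theorem hmap_comp_apply (k : ℕ) (g : C(Y, Z)) (f : C(X, Y)) (y : rationalHomology k X) :
    hmap k (g.comp f) y = hmap k g (hmap k f y) := by
  rw [hmap_comp, LinearMap.comp_apply]

theorem hmap_eq_of_homotopic (k : ℕ) {f g : C(X, Y)} (h : f.Homotopic g) :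
    hmap k f = hmap k g := by
  obtain ⟨H⟩ := h
  exact congrArg ModuleCat.Hom.hom
    (TopCat.Homotopy.congr_homologyMap_singularChainComplexFunctor
      (f := TopCat.ofHom f) (g := TopCat.ofHom g) H (ModuleCat.of ℚ (ULift.{u} ℚ)) k)

/-- A homeomorphism induces an isomorphism on rational homology. -/
def hmapEquiv (k : ℕ) (e : X ≃ₜ Y) : rationalHomology k X ≃ₗ[ℚ] rationalHomology k Y :=
  LinearEquiv.ofLinearMap (hmap k (e : C(X, Y))) (hmap k (e.symm : C(Y, X)))
    (by
      rw [← hmap_comp, ← hmap_id]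
      congr 1
      ext1 x
      simp)
    (by
      rw [← hmap_comp, ← hmap_id]
      congr 1
      ext1 x
      simp)

theorem homotopic_prod_real (f g : C(X, Y × ℝ)) (h : ∀ x, (f x).1 = (g x).1) :
    f.Homotopic g := by
  refine ⟨⟨⟨fun p => ((f p.2).1, (1 - (p.1 : ℝ)) * (f p.2).2 + p.1 * (g p.2).2), by fun_prop⟩,
    fun x => ?_, fun x => ?_⟩⟩
  · simp
  · simp [h x]

theorem hmap_eq_of_fst_eq (k : ℕ) (f g : C(X, Y × ℝ)) (h : ∀ x, (f x).1 = (g x).1) :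
    hmap k f = hmap k g :=
  hmap_eq_of_homotopic k (homotopic_prod_real f g h)

end Homology

/-! ### The homology of the product with a circle -/

section CircleProduct

variable (X : Type u) [TopologicalSpace X]

/-- The covering `X × ℝ → X × Circle`. -/
def expMap : C(X × ℝ, X × Circle) := ⟨fun z => (z.1, Circle.exp z.2), by fun_prop⟩

/-- The translation of `X × ℝ` by `j` turns. -/
def turnMap (j : ℤ) : C(X × ℝ, X × ℝ) := ⟨fun z => (z.1, z.2 + 2 * Real.pi * j), by fun_prop⟩

variable {X}

/-- The map `(x, s) ↦ (f x, a s)` of `X × ℝ`. -/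
def scaleMap (f : C(X, X)) (a : ℤ) : C(X × ℝ, X × ℝ) :=
  ⟨fun z => (f z.1, a * z.2), by fun_prop⟩

/-- The map `(x, w) ↦ (f x, w ^ a)` of `X × Circle`. -/
def powerMap (f : C(X, X)) (a : ℤ) : C(X × Circle, X × Circle) :=
  ⟨fun z => (f z.1, z.2 ^ a), by fun_prop⟩

variable (X)

theorem toSSet_map_app {Y : Type u} [TopologicalSpace Y] (f : C(X, Y)) (n : SimplexCategoryᵒᵖ)
    (s : (TopCat.toSSet.obj (TopCat.of X)).obj n) :
    (TopCat.of Y).toSSetObjEquiv n ((TopCat.toSSet.map (TopCat.ofHom f)).app n s) =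
      f.comp ((TopCat.of X).toSSetObjEquiv n s) :=
  rfl

instance stdSimplex_contractibleSpace (n : ℕ) : ContractibleSpace (stdSimplex ℝ (Fin (n + 1))) :=
  (convex_stdSimplex ℝ (Fin (n + 1))).contractibleSpace ⟨_, single_mem_stdSimplex ℝ 0⟩

open Simplicial in
/-- Singular simplices of `X × ℝ` are singular simplices of `X × Circle` together with an
integer. -/
def simplexLiftEquiv (n : ℕ) : (TopCat.toSSet.obj (TopCat.of (X × ℝ))) _⦋n⦌ ≃
    (TopCat.toSSet.obj (TopCat.of (X × Circle))) _⦋n⦌ × ℤ :=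
  ((TopCat.of (X × ℝ)).toSSetObjEquiv (.op ⦋n⦌)).trans
    ((liftEquiv (A := stdSimplex ℝ (Fin (n + 1))) X).trans
      (((TopCat.of (X × Circle)).toSSetObjEquiv (.op ⦋n⦌)).symm.prodCongr (Equiv.refl ℤ)))

theorem simplexLiftEquiv_fst (n : ℕ) (x) :
    (TopCat.toSSet.map (TopCat.ofHom (expMap X))).app (.op (.mk n)) x =
      (simplexLiftEquiv X n x).1 := by
  apply ((TopCat.of (X × Circle)).toSSetObjEquiv (.op (.mk n))).injective
  rw [toSSet_map_app]
  simp only [simplexLiftEquiv, Equiv.trans_apply, Equiv.prodCongr_apply, Prod.map_fst,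
    Equiv.apply_symm_apply]
  ext1 a
  exact (liftEquiv_fst X _ a).symm

theorem simplexLiftEquiv_turn (n : ℕ) (x) :
    simplexLiftEquiv X n ((TopCat.toSSet.map (TopCat.ofHom (turnMap X 1))).app (.op (.mk n)) x) =
      ((simplexLiftEquiv X n x).1, (simplexLiftEquiv X n x).2 + 1) := by
  simp only [simplexLiftEquiv, Equiv.trans_apply]
  rw [toSSet_map_app, liftEquiv_shift X ((TopCat.of (X × ℝ)).toSSetObjEquiv (.op (.mk n)) x)]
  · rfl
  · intro a
    simp [turnMap]

theorem turnMap_comp_expMap :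
    TopCat.toSSet.map (TopCat.ofHom (turnMap X 1)) ≫ TopCat.toSSet.map (TopCat.ofHom (expMap X)) =
      TopCat.toSSet.map (TopCat.ofHom (expMap X)) := by
  rw [← Functor.map_comp, ← TopCat.ofHom_comp]
  congr 2
  ext1 z
  refine Prod.ext rfl ?_
  exact Circle.exp_eq_exp.2 ⟨1, by simp [turnMap]⟩

/-- The complex `C(X × ℝ) → C(X × ℝ) → C(X × Circle)`. -/
abbrev circleShortComplex : ShortComplex (ChainComplex (ModuleCat.{u} ℚ) ℕ) :=
  coveringShortComplex (ModuleCat.of ℚ (ULift.{u} ℚ)) _ _ (turnMap_comp_expMap X)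

theorem circleShortComplex_shortExact : (circleShortComplex X).ShortExact :=
  HomologicalComplex.shortExact_of_degreewise_shortExact _ fun n =>
    (coveringSplitting _ _ _ (simplexLiftEquiv X) (turnMap_comp_expMap X)
      (simplexLiftEquiv_fst X) (simplexLiftEquiv_turn X) n).shortExact

/-- The translation is homotopic to the identity. Consequently the long exact sequence of the
covering breaks into short exact ones. -/
theorem homologyMap_turnMap_sub_id (k : ℕ) : HomologicalComplex.homologyMap
    (rationalChainsMap (turnMap X 1) - 𝟙 (rationalChains (X × ℝ))) k = 0 := by
  rw [HomologicalComplex.homologyMap_sub, HomologicalComplex.homologyMap_id, sub_eq_zero]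
  have h := hmap_eq_of_fst_eq k (turnMap X 1) (ContinuousMap.id _) fun _ => rfl
  rw [hmap_id] at h
  exact ModuleCat.hom_ext h

theorem homologyMap_circleShortComplex_f (k : ℕ) :
    HomologicalComplex.homologyMap (circleShortComplex X).f k = 0 :=
  homologyMap_turnMap_sub_id X k

variable {X}

/-- This is `(1 + t + ⋯ + t^(a-1))(t - 1) = t^a - 1`, combined with the fact that scaling by `a`
turns one translation into `a` translations. The signed sum covers negative `a`. -/
theorem intSum_comp_turnMap_sub_id (f : C(X, X)) (a : ℤ) :
    intSum (fun j => rationalChainsMap (scaleMap f a) ≫ rationalChainsMap (turnMap X j)) a ≫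
        (rationalChainsMap (turnMap X 1) - 𝟙 (rationalChains (X × ℝ))) =
      (rationalChainsMap (turnMap X 1) - 𝟙 (rationalChains (X × ℝ))) ≫
        rationalChainsMap (scaleMap f a) := by
  have h : intSum (fun j => rationalChainsMap (scaleMap f a) ≫ rationalChainsMap (turnMap X j)) a ≫
      (rationalChainsMap (turnMap X 1) - 𝟙 (rationalChains (X × ℝ))) = intSum (fun j =>
        (rationalChainsMap (scaleMap f a) ≫ rationalChainsMap (turnMap X j)) ≫
          (rationalChainsMap (turnMap X 1) - 𝟙 (rationalChains (X × ℝ)))) a :=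
    map_intSum (Preadditive.rightComp (rationalChains (X × ℝ))
    (rationalChainsMap (turnMap X 1) - 𝟙 (rationalChains (X × ℝ))))
    (fun j => rationalChainsMap (scaleMap f a) ≫ rationalChainsMap (turnMap X j)) a
  have hj : ∀ j, (rationalChainsMap (scaleMap f a) ≫ rationalChainsMap (turnMap X j)) ≫
      (rationalChainsMap (turnMap X 1) - 𝟙 (rationalChains (X × ℝ))) =
      rationalChainsMap ((turnMap X (j + 1)).comp (scaleMap f a)) -
      rationalChainsMap ((turnMap X j).comp (scaleMap f a)) := fun j => by
    rw [Preadditive.comp_sub, Category.comp_id, ← rationalChainsMap_comp,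
      ← rationalChainsMap_comp]
    congr 2
    ext1 z
    refine Prod.ext rfl ?_
    simp [turnMap]
    ring
  rw [h]
  simp only [hj]
  rw [intSum_telescope (fun j => rationalChainsMap ((turnMap X j).comp (scaleMap f a))),
    Preadditive.sub_comp, Category.id_comp, ← rationalChainsMap_comp]
  congr 2
  · ext1 z
    refine Prod.ext rfl ?_
    simp [turnMap, scaleMap]
    ring
  · ext1 z
    refine Prod.ext rfl ?_
    simp [turnMap, scaleMap]

/-- The endomorphism of `circleShortComplex X` given by `powerMap f a`. -/
def powerShortComplexMap (f : C(X, X)) (a : ℤ) : circleShortComplex X ⟶ circleShortComplex X where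
  τ₁ := intSum (fun j => rationalChainsMap (scaleMap f a) ≫ rationalChainsMap (turnMap X j)) a
  τ₂ := rationalChainsMap (scaleMap f a)
  τ₃ := rationalChainsMap (powerMap f a)
  comm₁₂ := intSum_comp_turnMap_sub_id f a
  comm₂₃ := by
    change rationalChainsMap _ ≫ rationalChainsMap _ = rationalChainsMap _ ≫ rationalChainsMap _
    rw [← rationalChainsMap_comp, ← rationalChainsMap_comp]
    congr 1
    ext1 z
    refine Prod.ext rfl ?_
    simp [expMap, scaleMap, powerMap]

/-- All terms of the signed sum are homotopic to `scaleMap f a`. This is the source of the factor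
`a` by which the degree of `w ↦ w ^ a` acts on homology. -/
theorem homologyMap_powerShortComplexMap_τ₁ (f : C(X, X)) (a : ℤ) (k : ℕ) :
    HomologicalComplex.homologyMap (powerShortComplexMap f a).τ₁ k =
      a • ModuleCat.ofHom (hmap k (scaleMap f a)) := by
  have h := map_intSum ((HomologicalComplex.homologyFunctor (ModuleCat.{u} ℚ)
    (ComplexShape.down ℕ) k).mapAddHom)
    (fun j => rationalChainsMap (scaleMap f a) ≫ rationalChainsMap (turnMap X j)) a
  refine h.trans ?_
  rw [← intSum_const]
  congr 1
  funext j
  rw [← rationalChainsMap_comp]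
  exact ModuleCat.hom_ext (hmap_eq_of_fst_eq k ((turnMap X j).comp (scaleMap f a)) (scaleMap f a)
    fun _ => rfl)

variable (X) in
/-- The base point section `x ↦ (x, 1)`. -/
def inclMap : C(X, X × Circle) := ⟨fun x => (x, 1), by fun_prop⟩

variable (X) in
-- The section at height zero is a homotopy equivalence `X → X × ℝ`, and `inclMap` is its composite
-- with the covering.
theorem range_hmap_expMap (k : ℕ) :
    LinearMap.range (hmap k (expMap X)) = LinearMap.range (hmap k (inclMap X)) := by
  let i : C(X, X × ℝ) := ⟨fun x => (x, 0), by fun_prop⟩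
  have h1 : inclMap X = (expMap X).comp i := by
    ext1 x
    simp [inclMap, expMap, i]
  have h2 : hmap k (i.comp ContinuousMap.fst) = hmap k (ContinuousMap.id (X × ℝ)) :=
    hmap_eq_of_fst_eq k _ _ fun _ => rfl
  apply le_antisymm
  · rintro _ ⟨z, rfl⟩
    refine ⟨hmap k ContinuousMap.fst z, ?_⟩
    rw [h1, hmap_comp_apply, ← hmap_comp_apply k i, h2, hmap_id, LinearMap.id_apply]
  · rw [h1, hmap_comp]
    exact LinearMap.range_comp_le_range _ _

variable (X) in
theorem hmap_inclMap_zero_surjective : Function.Surjective (hmap 0 (inclMap X)) := by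
  rw [← LinearMap.range_eq_top, ← range_hmap_expMap, LinearMap.range_eq_top]
  have hS := circleShortComplex_shortExact X
  have := hS.epi_g
  have h := HomologicalComplex.epi_homologyMap_of_epi_of_not_rel
    (circleShortComplex X).g 0 (by simp)
  exact (ModuleCat.epi_iff_surjective _).1 h

variable (X) in
/-- The connecting homomorphism `H_{k+1}(X × Circle) → H_k(X × ℝ)`. -/
def connectingReal (k : ℕ) :
    rationalHomology (k + 1) (X × Circle) →ₗ[ℚ] rationalHomology k (X × ℝ) :=
  ((circleShortComplex_shortExact X).δ (k + 1) k (by simp)).hom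

/-- The next map of the long exact sequence is induced by `t - 1`, which is zero on homology. -/
theorem connectingReal_surjective (k : ℕ) : Function.Surjective (connectingReal X k) := by
  intro z
  have h := (circleShortComplex_shortExact X).homology_exact₁ (k + 1) k (by simp)
  refine (ShortComplex.moduleCat_exact_iff _).1 h z ?_
  change (HomologicalComplex.homologyMap (circleShortComplex X).f k).hom z = 0
  rw [homologyMap_circleShortComplex_f]
  rfl

theorem ker_connectingReal (k : ℕ) :
    LinearMap.ker (connectingReal X k) = LinearMap.range (hmap (k + 1) (expMap X)) :=
  ((ShortComplex.moduleCat_exact_iff_range_eq_ker _).1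
    ((circleShortComplex_shortExact X).homology_exact₃ (k + 1) k (by simp))).symm

theorem connectingReal_powerMap (k : ℕ) (f : C(X, X)) (a : ℤ)
    (y : rationalHomology (k + 1) (X × Circle)) :
    connectingReal X k (hmap (k + 1) (powerMap f a) y) =
      a • hmap k (scaleMap f a) (connectingReal X k y) := by
  have h := HomologicalComplex.HomologySequence.δ_naturality (powerShortComplexMap f a)
    (circleShortComplex_shortExact X) (circleShortComplex_shortExact X) (k + 1) k (by simp)
  rw [homologyMap_powerShortComplexMap_τ₁] at h
  exact (LinearMap.congr_fun (congrArg ModuleCat.Hom.hom h) y).symm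

variable (X) in
/-- The connecting homomorphism `H_{k+1}(X × Circle) → H_k(X)`. -/
def connecting (k : ℕ) : rationalHomology (k + 1) (X × Circle) →ₗ[ℚ] rationalHomology k X :=
  hmap k (ContinuousMap.fst : C(X × ℝ, X)) ∘ₗ
    connectingReal X k

theorem hmap_fst_bijective (k : ℕ) :
    Function.Bijective (hmap k (ContinuousMap.fst : C(X × ℝ, X))) := by
  let i : C(X, X × ℝ) := ⟨fun x => (x, 0), by fun_prop⟩
  have h2 : hmap k (i.comp ContinuousMap.fst) = hmap k (ContinuousMap.id (X × ℝ)) :=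
    hmap_eq_of_fst_eq k _ _ fun _ => rfl
  have h3 : (ContinuousMap.fst : C(X × ℝ, X)).comp i = ContinuousMap.id X := rfl
  refine Function.bijective_iff_has_inverse.2 ⟨hmap k i, fun z => ?_, fun z => ?_⟩
  · rw [← hmap_comp_apply, h2, hmap_id, LinearMap.id_apply]
  · rw [← hmap_comp_apply, h3, hmap_id, LinearMap.id_apply]

theorem connecting_surjective (k : ℕ) : Function.Surjective (connecting X k) := by
  rw [connecting, LinearMap.coe_comp]
  exact (hmap_fst_bijective k).2.comp (connectingReal_surjective k)

variable (X) in
theorem ker_connecting (k : ℕ) :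
    LinearMap.ker (connecting X k) = LinearMap.range (hmap (k + 1) (inclMap X)) := by
  rw [connecting, LinearMap.ker_comp_of_ker_eq_bot _
    (LinearMap.ker_eq_bot.2 (hmap_fst_bijective k).1), ← range_hmap_expMap, ker_connectingReal]

theorem connecting_powerMap (k : ℕ) (f : C(X, X)) (a : ℤ)
    (y : rationalHomology (k + 1) (X × Circle)) :
    connecting X k (hmap (k + 1) (powerMap f a) y) = a • hmap k f (connecting X k y) := by
  have h1 : (ContinuousMap.fst : C(X × ℝ, X)).comp (scaleMap f a) = f.comp ContinuousMap.fst := rfl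
  rw [connecting, LinearMap.comp_apply, connectingReal_powerMap, map_zsmul, ← hmap_comp_apply, h1,
    hmap_comp_apply, LinearMap.comp_apply]

end CircleProduct

/-! ### Splitting the homology of `X × Circle`; Lefschetz numbers of `powerMap` -/

section CircleProductSplitting

variable (X : Type u) [TopologicalSpace X]

theorem hmap_fst_inclMap (k : ℕ) (x : rationalHomology k X) :
    hmap k (ContinuousMap.fst : C(X × Circle, X)) (hmap k (inclMap X) x) = x := by
  have h : (ContinuousMap.fst : C(X × Circle, X)).comp (inclMap X) = ContinuousMap.id X := rfl
  rw [← hmap_comp_apply, h, hmap_id, LinearMap.id_apply]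

/-- `H₀(X × Circle) ≃ H₀(X)`. -/
def circleEquivZero : rationalHomology 0 (X × Circle) ≃ₗ[ℚ] rationalHomology 0 X :=
  LinearEquiv.ofBijective (hmap 0 ContinuousMap.fst)
    (by
      refine Function.bijective_iff_has_inverse.2 ⟨hmap 0 (inclMap X), fun z => ?_,
        hmap_fst_inclMap X 0⟩
      obtain ⟨x, rfl⟩ := hmap_inclMap_zero_surjective X z
      rw [hmap_fst_inclMap])

/-- `H_{k+1}(X × Circle) ≃ H_{k+1}(X) × H_k(X)`. -/
def circleEquivSucc (k : ℕ) : rationalHomology (k + 1) (X × Circle) ≃ₗ[ℚ]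
    rationalHomology (k + 1) X × rationalHomology k X :=
  LinearEquiv.ofBijective ((hmap (k + 1) ContinuousMap.fst).prod (connecting X k))
    (by
      have hki : ∀ x, connecting X k (hmap (k + 1) (inclMap X) x) = 0 := fun x => by
        rw [← LinearMap.mem_ker, ker_connecting]
        exact ⟨x, rfl⟩
      constructor
      · rw [injective_iff_map_eq_zero]
        intro z hz
        obtain ⟨h1, h2⟩ := Prod.mk_eq_zero.1 hz
        rw [← LinearMap.mem_ker, ker_connecting] at h2
        obtain ⟨x, rfl⟩ := h2
        rw [hmap_fst_inclMap] at h1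
        rw [h1, map_zero]
      · rintro ⟨x, z⟩
        obtain ⟨w, rfl⟩ := connecting_surjective k z
        refine ⟨w + hmap (k + 1) (inclMap X) (x - hmap (k + 1) ContinuousMap.fst w), ?_⟩
        simp [hmap_fst_inclMap, hki])

theorem circleEquivSucc_apply (k : ℕ) (y : rationalHomology (k + 1) (X × Circle)) :
    circleEquivSucc X k y = (hmap (k + 1) ContinuousMap.fst y, connecting X k y) :=
  rfl

variable {X}

theorem circleEquivZero_powerMap (f : C(X, X)) (a : ℤ) (y) :
    circleEquivZero X (hmap 0 (powerMap f a) y) = hmap 0 f (circleEquivZero X y) := by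
  have h : (ContinuousMap.fst : C(X × Circle, X)).comp (powerMap f a) =
    f.comp ContinuousMap.fst := rfl
  simp only [circleEquivZero, LinearEquiv.ofBijective_apply]
  rw [← hmap_comp_apply, h, hmap_comp_apply]

theorem circleEquivSucc_powerMap (k : ℕ) (f : C(X, X)) (a : ℤ) (y) :
    circleEquivSucc X k (hmap (k + 1) (powerMap f a) y) =
      (hmap (k + 1) f (circleEquivSucc X k y).1, a • hmap k f (circleEquivSucc X k y).2) := by
  have h : (ContinuousMap.fst : C(X × Circle, X)).comp (powerMap f a) =
    f.comp ContinuousMap.fst := rfl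
  simp only [circleEquivSucc_apply]
  rw [← hmap_comp_apply, h, hmap_comp_apply, connecting_powerMap]

/-- On homology, `f × (w ↦ w ^ a)` is an affine function of `a`. -/
theorem hmap_powerMap_affine (k : ℕ) (f : C(X, X)) (a : ℤ) :
    hmap k (powerMap f a) = hmap k (powerMap f 0) +
      (a : ℚ) • (hmap k (powerMap f 1) - hmap k (powerMap f 0)) := by
  ext y
  simp only [LinearMap.add_apply, LinearMap.smul_apply, LinearMap.sub_apply]
  cases k with
  | zero =>
    apply (circleEquivZero X).injective
    simp [circleEquivZero_powerMap]
  | succ k =>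
    apply (circleEquivSucc X k).injective
    simp only [map_add, map_smul, map_sub, circleEquivSucc_powerMap]
    ext <;> simp [Int.cast_smul_eq_zsmul]

/-- Finite-dimensional rational homology, concentrated in degrees at most `d`. -/
structure FiniteHomology (d : ℕ) (X : Type u) [TopologicalSpace X] : Prop where
  finite : ∀ k, Module.Finite ℚ (rationalHomology k X)
  subsingleton : ∀ k, d < k → Subsingleton (rationalHomology k X)

theorem FiniteHomology.prod_circle {d : ℕ} (h : FiniteHomology d X) :
    FiniteHomology (d + 1) (X × Circle) where
  finite k := by
    have := h.finite
    cases k with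
    | zero => exact Module.Finite.equiv (circleEquivZero X).symm
    | succ k => exact Module.Finite.equiv (circleEquivSucc X k).symm
  subsingleton k hk := by
    obtain ⟨k, rfl⟩ := Nat.exists_eq_succ_of_ne_zero (show k ≠ 0 by omega)
    have := h.subsingleton k (by omega)
    have := h.subsingleton (k + 1) (by omega)
    exact (circleEquivSucc X k).toEquiv.subsingleton

theorem FiniteHomology.homeomorph {Y : Type u} [TopologicalSpace Y] {d : ℕ}
    (h : FiniteHomology d X) (e : X ≃ₜ Y) : FiniteHomology d Y where
  finite k := by
    have := h.finite k
    exact Module.Finite.equiv (hmapEquiv k e)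
  subsingleton k hk := by
    have := h.subsingleton k hk
    exact (hmapEquiv k e).symm.toEquiv.subsingleton

theorem FiniteHomology.lefschetzNumber_eq {d : ℕ} (h : FiniteHomology d X) (f : C(X, X)) {N : ℕ}
    (hN : d < N) : lefschetzNumber f =
      ∑ k ∈ Finset.range N, (-1) ^ k * LinearMap.trace ℚ (rationalHomology k X) (hmap k f) := by
  refine finsum_eq_sum_of_support_subset _ fun k hk => ?_
  by_contra hkN
  have := h.subsingleton k (by simp at hkN; omega)
  apply hk
  have h0 : rationalHomologyMap k f = 0 := Subsingleton.elim _ _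
  simp only [h0, map_zero, mul_zero]

theorem lefschetzNumber_conj {Y : Type u} [TopologicalSpace Y] (e : X ≃ₜ Y) (f : C(X, X))
    (g : C(Y, Y)) (h : ∀ x, e (f x) = g (e x)) : lefschetzNumber f = lefschetzNumber g := by
  refine finsum_congr fun k => ?_
  rw [rationalHomologyMap_eq_hmap, rationalHomologyMap_eq_hmap,
    ← LinearMap.trace_conj' _ (hmapEquiv k e)]
  congr 2
  have hc : (e : C(X, Y)).comp (f.comp (e.symm : C(Y, X))) = g := by
    ext1 y
    simp [h]
  rw [LinearEquiv.conj_apply, ← hc, hmap_comp, hmap_comp]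
  rfl

theorem trace_powerMap_zero (f : C(X, X)) (a : ℤ) :
    LinearMap.trace ℚ _ (hmap 0 (powerMap f a)) = LinearMap.trace ℚ _ (hmap 0 f) := by
  rw [← LinearMap.trace_conj' _ (circleEquivZero X)]
  congr 1
  ext1 y
  simp [LinearEquiv.conj_apply, circleEquivZero_powerMap]

theorem FiniteHomology.trace_powerMap_succ {d : ℕ} (h : FiniteHomology d X) (k : ℕ) (f : C(X, X))
    (a : ℤ) : LinearMap.trace ℚ _ (hmap (k + 1) (powerMap f a)) =
      LinearMap.trace ℚ _ (hmap (k + 1) f) + a * LinearMap.trace ℚ _ (hmap k f) := by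
  have := h.finite
  rw [← LinearMap.trace_conj' _ (circleEquivSucc X k), ← smul_eq_mul, ← map_smul,
    ← LinearMap.trace_prodMap']
  congr 1
  refine LinearMap.ext fun y => ?_
  simp only [LinearEquiv.conj_apply, LinearMap.comp_apply, LinearEquiv.coe_coe,
    circleEquivSucc_powerMap, LinearEquiv.apply_symm_apply]
  ext <;> simp [Int.cast_smul_eq_zsmul]

/-- The summand `H_k(X)` of `H_{k+1}(X × Circle)` contributes `a` times the trace of `f`, one degree
higher and so with the opposite sign: hence `1 - a`. -/
theorem FiniteHomology.lefschetzNumber_powerMap {d : ℕ} (h : FiniteHomology d X) (f : C(X, X))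
    (a : ℤ) : lefschetzNumber (powerMap f a) = (1 - a) * lefschetzNumber f := by
  -- The sum for `f` is expanded to two lengths: `d + 2` to match `H_{k+1}(X)` once degree zero is
  -- split off, and `d + 1` to match the shifted `H_k(X)`.
  have h1 := h.lefschetzNumber_eq f (N := d + 2) (by omega)
  rw [Finset.sum_range_succ'] at h1
  rw [h.prod_circle.lefschetzNumber_eq (powerMap f a) (N := d + 2) (by omega),
    Finset.sum_range_succ', trace_powerMap_zero, sub_mul, one_mul]
  conv_rhs =>
    congr
    · rw [h1]
    · rw [h.lefschetzNumber_eq f (N := d + 1) (by omega)]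
  rw [Finset.mul_sum, add_sub_right_comm, ← Finset.sum_sub_distrib]
  congr 1
  refine Finset.sum_congr rfl fun k _ => ?_
  rw [h.trace_powerMap_succ]
  ring

theorem lefschetzNumber_of_unique [Unique X] (f : C(X, X)) :
    FiniteHomology 0 X ∧ lefschetzNumber f = 1 := by
  let Q : ModuleCat.{u} ℚ := ModuleCat.of ℚ (ULift.{u} ℚ)
  have hsub : ∀ k, 0 < k → Subsingleton (rationalHomology k X) := fun k hk =>
    ModuleCat.subsingleton_of_isZero
      (AlgebraicTopology.isZero_singularHomologyFunctor_of_totallyDisconnectedSpace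
        (ModuleCat.{u} ℚ) k Q (TopCat.of X) hk.ne')
  have : PathConnectedSpace (TopCat.of X) := inferInstanceAs (PathConnectedSpace X)
  let e : rationalHomology 0 X ≃ₗ[ℚ] ℚ :=
    (asIso ((TopCat.of X).singularHomology₀ε Q)).toLinearEquiv.trans ULift.moduleEquiv
  have hfin : FiniteHomology 0 X := by
    refine ⟨fun k => ?_, hsub⟩
    cases k with
    | zero => exact Module.Finite.equiv e.symm
    | succ k =>
      have := hsub (k + 1) k.succ_pos
      infer_instance
  refine ⟨hfin, ?_⟩
  have hf : f = ContinuousMap.id X := by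
    ext1 x
    exact Subsingleton.elim _ _
  have := hfin.finite 0
  rw [hfin.lefschetzNumber_eq f (N := 1) one_pos, hf, Finset.sum_range_one, hmap_id,
    LinearMap.trace_id, e.finrank_eq]
  simp

end CircleProductSplitting

/-! ### Lefschetz numbers of endomorphisms of tori -/

section Torus

variable {ι κ μ : Type u} [Fintype ι] [Fintype μ]

/-- The homomorphism of tori given by an integer matrix. -/
def matrixMap (A : Matrix κ ι ℤ) : C(ι → Circle, κ → Circle) :=
  ⟨fun x i => ∏ j, x j ^ A i j, by fun_prop⟩

theorem matrixMap_apply (A : Matrix κ ι ℤ) (x : ι → Circle) (i : κ) :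
    matrixMap A x i = ∏ j, x j ^ A i j :=
  rfl

theorem matrixMap_mul (A : Matrix κ μ ℤ) (B : Matrix μ ι ℤ) :
    matrixMap (A * B) = (matrixMap A).comp (matrixMap B) := by
  ext1 x
  funext i
  simp only [matrixMap_apply, ContinuousMap.comp_apply, Matrix.mul_apply,
    ← Finset.prod_zpow, ← zpow_mul]
  rw [Finset.prod_comm]
  refine Finset.prod_congr rfl fun j _ => ?_
  simp only [mul_comm (A i _)]
  exact congrArg Additive.toMul
    (map_sum (zmultiplesHom (Additive Circle) (Additive.ofMul (x j))) _ Finset.univ)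

/-- Raising the coordinates to the powers `a`. -/
def diagonalMap (a : ι → ℤ) : C(ι → Circle, ι → Circle) :=
  ⟨fun x i => x i ^ a i, by fun_prop⟩

theorem matrixMap_diagonal [DecidableEq ι] (a : ι → ℤ) :
    matrixMap (Matrix.diagonal a) = diagonalMap a := by
  ext1 x
  funext i
  rw [matrixMap_apply, Finset.prod_eq_single i]
  · rw [Matrix.diagonal_apply_eq]
    rfl
  · intro j _ hj
    rw [Matrix.diagonal_apply_ne' _ hj, zpow_zero]
  · intro h
    exact absurd (Finset.mem_univ i) h

/-- Splitting off one coordinate of a torus. -/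
def splitCoord [DecidableEq ι] (i : ι) :
    (ι → Circle) ≃ₜ ({j // j ≠ i} → Circle) × Circle :=
  (Homeomorph.funSplitAt Circle i).trans (Homeomorph.prodComm _ _)

theorem splitCoord_diagonalMap {ι : Type u} [DecidableEq ι] (i : ι) (a : ι → ℤ) (x : ι → Circle) :
    splitCoord i (diagonalMap a x) =
      powerMap (diagonalMap fun j : {j // j ≠ i} => a j) (a i) (splitCoord i x) :=
  rfl

theorem torus_homology (n : ℕ) : ∀ (ι : Type u) [Fintype ι], Fintype.card ι = n →
    FiniteHomology n (ι → Circle) ∧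
      ∀ a : ι → ℤ, lefschetzNumber (diagonalMap a) = ∏ i, (1 - (a i : ℚ)) := by
  classical
  induction n with
  | zero =>
    intro ι _ h
    have := Fintype.card_eq_zero_iff.1 h
    exact ⟨(lefschetzNumber_of_unique (ContinuousMap.id _)).1, fun a => by
      rw [(lefschetzNumber_of_unique _).2, Finset.univ_eq_empty, Finset.prod_empty]⟩
  | succ n ih =>
    intro ι _ h
    obtain ⟨i⟩ : Nonempty ι := Fintype.card_pos_iff.1 (by omega)
    obtain ⟨h1, h2⟩ := ih {j // j ≠ i} (by rw [Fintype.card_subtype_compl,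
      Fintype.card_subtype_eq, h, Nat.add_sub_cancel])
    refine ⟨h1.prod_circle.homeomorph (splitCoord i).symm, fun a => ?_⟩
    rw [lefschetzNumber_conj (splitCoord i) _ _ (splitCoord_diagonalMap i a),
      h1.lefschetzNumber_powerMap, h2, Fintype.prod_eq_mul_prod_subtype_ne _ i]

theorem torus_finiteHomology (ι : Type u) [Fintype ι] :
    FiniteHomology (Fintype.card ι) (ι → Circle) :=
  (torus_homology _ ι rfl).1

theorem lefschetzNumber_diagonalMap (a : ι → ℤ) :
    lefschetzNumber (diagonalMap a) = ∏ i, (1 - (a i : ℚ)) :=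
  (torus_homology _ ι rfl).2 a

theorem hmap_diagonalMap_eq {ι : Type u} [DecidableEq ι] (k : ℕ) (i : ι) (a : ι → ℤ) :
    hmap k (diagonalMap a) = (hmapEquiv k (splitCoord i)).symm.conj
      (hmap k (powerMap (diagonalMap fun j : {j // j ≠ i} => a j) (a i))) := by
  have h : diagonalMap a = ((splitCoord i).symm : C(_, _)).comp
      ((powerMap (diagonalMap fun j : {j // j ≠ i} => a j) (a i)).comp
        (splitCoord i : C(_, _))) := by
    ext1 x
    exact ((splitCoord i).symm_apply_apply _).symm
  rw [LinearEquiv.conj_apply]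
  conv_lhs => rw [h, hmap_comp, hmap_comp]
  rfl

theorem hmap_diagonalMap_affine {ι : Type u} [DecidableEq ι] (k : ℕ) (i : ι) (a : ι → ℤ) (m : ℤ) :
    hmap k (diagonalMap (Function.update a i m)) = hmap k (diagonalMap (Function.update a i 0)) +
      (m : ℚ) • (hmap k (diagonalMap (Function.update a i 1)) -
        hmap k (diagonalMap (Function.update a i 0))) := by
  have h : ∀ m, (fun j : {j // j ≠ i} => Function.update a i m j) =
      fun j : {j // j ≠ i} => a j := fun m => by
    funext j
    exact Function.update_of_ne j.2 _ _
  simp only [hmap_diagonalMap_eq k i, h, Function.update_self]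
  rw [hmap_powerMap_affine, map_add, map_smul, map_sub]

/-- Each entry of `A` gets its own circle: copy `x j` to every `(i, j)`, raise to the power `A i j`,
multiply along rows. Only the middle factor depends on `A`, and its action on homology is affine in
each entry. -/
theorem matrixMap_eq_sum_comp_diagonalMap_comp_copy [DecidableEq ι] (A : Matrix ι ι ℤ) :
    matrixMap A = (matrixMap (Matrix.of fun (i : ι) (p : ι × ι) => if p.1 = i then 1 else 0)).comp
      ((diagonalMap fun p : ι × ι => A p.1 p.2).comp
        (matrixMap (Matrix.of fun (p : ι × ι) (j : ι) => if p.2 = j then 1 else 0))) := by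
  rw [← matrixMap_diagonal, ← matrixMap_mul, ← matrixMap_mul]
  congr 1
  ext i j
  simp [Matrix.mul_apply, Fintype.sum_prod_type, Matrix.diagonal_apply, ite_and]

/-- The Lefschetz number of an endomorphism of a torus depends only on the order of composition up
to cyclic permutation. -/
theorem lefschetzNumber_matrixMap_mul_comm (A B : Matrix ι ι ℤ) :
    lefschetzNumber (matrixMap (A * B)) = lefschetzNumber (matrixMap (B * A)) := by
  refine finsum_congr fun k => ?_
  have := (torus_finiteHomology ι).finite k
  rw [rationalHomologyMap_eq_hmap, rationalHomologyMap_eq_hmap, matrixMap_mul, matrixMap_mul,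
    hmap_comp, hmap_comp, LinearMap.trace_comp_comm']

/-- A function on `ℤ^ι` which is affine in each variable is a polynomial. -/
theorem exists_mvPolynomial_of_affine {σ : Type*} [Fintype σ] [DecidableEq σ] (φ : (σ → ℤ) → ℚ)
    (h : ∀ a i m, φ (Function.update a i m) = φ (Function.update a i 0) +
      m * (φ (Function.update a i 1) - φ (Function.update a i 0))) :
    ∃ p : MvPolynomial σ ℚ, ∀ a, φ a = MvPolynomial.eval (fun i => (a i : ℚ)) p := by
  -- The variables in `S` are free and the others are frozen at `b`. Freeing `i` interpolates
  -- linearly between the polynomials with `i` frozen at `0` and at `1`.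
  have key : ∀ (S : Finset σ) (b : σ → ℤ), ∃ p : MvPolynomial σ ℚ, ∀ a,
      φ (S.piecewise a b) = MvPolynomial.eval (fun i => (a i : ℚ)) p := by
    intro S
    induction S using Finset.induction_on with
    | empty =>
      intro b
      exact ⟨MvPolynomial.C (φ b), fun a => by simp⟩
    | insert i S hi ih =>
      intro b
      obtain ⟨p, hp⟩ := ih (Function.update b i 0)
      obtain ⟨q, hq⟩ := ih (Function.update b i 1)
      refine ⟨p + MvPolynomial.X i * (q - p), fun a => ?_⟩
      have hu : ∀ m, Function.update (S.piecewise a b) i m =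
          S.piecewise a (Function.update b i m) := fun m =>
        (Finset.update_piecewise_of_notMem S a b hi m)
      rw [Finset.piecewise_insert, h, hu, hu, hp, hq]
      simp
  obtain ⟨p, hp⟩ := key Finset.univ 0
  exact ⟨p, fun a => by rw [← hp, Finset.piecewise_univ]⟩

/-- The Lefschetz number of an endomorphism of a torus is a polynomial in its matrix. -/
theorem exists_mvPolynomial_lefschetzNumber_matrixMap (ι : Type u) [Fintype ι] [DecidableEq ι] :
    ∃ p : MvPolynomial (ι × ι) ℚ, ∀ A : Matrix ι ι ℤ,
      lefschetzNumber (matrixMap A) = MvPolynomial.eval (fun i => (A i.1 i.2 : ℚ)) p := by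
  have hk : ∀ k, ∃ p : MvPolynomial (ι × ι) ℚ, ∀ A : Matrix ι ι ℤ,
      LinearMap.trace ℚ _ (hmap k (matrixMap A)) =
        MvPolynomial.eval (fun i => (A i.1 i.2 : ℚ)) p := by
    intro k
    obtain ⟨p, hp⟩ := exists_mvPolynomial_of_affine (σ := ι × ι) (fun a =>
      LinearMap.trace ℚ _ (hmap k ((matrixMap (Matrix.of fun (i : ι) (p : ι × ι) =>
        if p.1 = i then 1 else 0)).comp ((diagonalMap a).comp
        (matrixMap (Matrix.of fun (p : ι × ι) (j : ι) => if p.2 = j then 1 else 0)))))) (by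
      intro a i m
      simp only [hmap_comp]
      conv_lhs => rw [hmap_diagonalMap_affine]
      simp only [LinearMap.add_comp, LinearMap.smul_comp, LinearMap.sub_comp, LinearMap.comp_add,
        LinearMap.comp_smul, LinearMap.comp_sub, map_add, map_sub, map_smul, smul_eq_mul])
    refine ⟨p, fun A => ?_⟩
    rw [← hp (fun p => A p.1 p.2), ← matrixMap_eq_sum_comp_diagonalMap_comp_copy]
  choose p hp using hk
  refine ⟨∑ k ∈ Finset.range (Fintype.card ι + 1), MvPolynomial.C ((-1) ^ k) * p k, fun A => ?_⟩
  rw [(torus_finiteHomology ι).lefschetzNumber_eq _ (Nat.lt_succ_self _), map_sum]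
  refine Finset.sum_congr rfl fun k _ => ?_
  rw [hp, map_mul, MvPolynomial.eval_C]

end Torus

/-! ### Triangularization over an algebraically closed field -/

section Triangularization

universe w

open Module

variable {K : Type*} [Field K] [IsAlgClosed K]

/-- For an eigenvalue `l` the range of `f - l` is proper, hence inside the kernel of a non-zero
functional. That hyperplane is `f`-invariant; a triangular basis of it is extended by a vector
outside, placed first. -/
theorem exists_triangular_basis (n : ℕ) : ∀ {V : Type w} [AddCommGroup V] [Module K V]
    [FiniteDimensional K V] (_ : finrank K V = n) (f : End K V),
    ∃ b : Basis (Fin n) K V, ∀ i j, i < j → b.repr (f (b j)) i = 0 := by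
  induction n with
  | zero =>
    intro V _ _ _ h f
    exact ⟨finBasisOfFinrankEq K V h, fun i => i.elim0⟩
  | succ n ih =>
    intro V _ _ _ h f
    have : Nontrivial V := nontrivial_of_finrank_eq_succ h
    obtain ⟨l, hl⟩ := End.exists_eigenvalue f
    have hne : LinearMap.range (f - algebraMap K (End K V) l) < ⊤ := by
      refine lt_top_iff_ne_top.2 fun htop => ?_
      obtain ⟨v, hv⟩ := hl.exists_hasEigenvector
      have hinj := LinearMap.injective_iff_surjective.2 (LinearMap.range_eq_top.1 htop)
      refine hv.2 (hinj ?_)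
      rw [map_zero, LinearMap.sub_apply, algebraMap_end_apply, hv.apply_eq_smul, sub_self]
    obtain ⟨φ, hφ, hle⟩ := Submodule.exists_le_ker_of_lt_top _ hne
    have hsurj : Function.Surjective φ := LinearMap.surjective hφ
    obtain ⟨y, hy⟩ := hsurj 1
    have hf : ∀ x ∈ LinearMap.ker φ, f x ∈ LinearMap.ker φ := fun x hx => by
      have h1 := hle (LinearMap.mem_range_self (f - algebraMap K (End K V) l) x)
      rw [LinearMap.sub_apply, algebraMap_end_apply] at h1
      have h2 := Submodule.add_mem _ h1 (Submodule.smul_mem _ l hx)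
      rwa [sub_add_cancel] at h2
    have hrank : finrank K (LinearMap.ker φ) = n := by
      have h1 := LinearMap.finrank_range_add_finrank_ker φ
      rw [LinearMap.range_eq_top.2 hsurj, finrank_top, finrank_self, h] at h1
      omega
    obtain ⟨b, hb⟩ := ih hrank (f.restrict hf)
    let b' : Basis (Fin (n + 1)) K V := Basis.mkFinCons y b
      (fun c x hx hc => by
        have h1 := congrArg φ hc
        rwa [map_add, map_smul, hy, LinearMap.mem_ker.1 hx, map_zero, add_zero, smul_eq_mul,
          mul_one] at h1)
      (fun z => ⟨-φ z, by
        rw [LinearMap.mem_ker, map_add, map_smul, hy, smul_eq_mul, mul_one, add_neg_cancel]⟩)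
    have hbs : ∀ i, b' (Fin.succ i) = b i := fun i => by simp [b']
    have h0 : ∀ x : LinearMap.ker φ, b'.repr x 0 = 0 := fun x => by
      have h1 : b'.coord 0 ∘ₗ (LinearMap.ker φ).subtype = 0 := by
        refine b.ext fun i => ?_
        simp [← hbs]
      exact LinearMap.congr_fun h1 x
    have hs : ∀ (x : LinearMap.ker φ) i, b'.repr x (Fin.succ i) = b.repr x i := fun x i => by
      have h1 : b'.coord (Fin.succ i) ∘ₗ (LinearMap.ker φ).subtype = b.coord i := by
        refine b.ext fun j => ?_
        simp [← hbs, Finsupp.single_apply]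
      exact LinearMap.congr_fun h1 x
    refine ⟨b', fun i j hij => ?_⟩
    obtain ⟨j, rfl⟩ := Fin.exists_succ_eq.2 (Fin.ne_zero_of_lt hij)
    have hj : f (b' j.succ) = (f.restrict hf (b j) : LinearMap.ker φ) := by
      rw [hbs]
      rfl
    rw [hj]
    induction i using Fin.cases with
    | zero => exact h0 _
    | succ i =>
      rw [hs]
      exact hb i j (Fin.succ_lt_succ_iff.1 hij)

theorem exists_triangularization {ι : Type*} [Fintype ι] [DecidableEq ι]
    (A : Matrix ι ι K) :
    ∃ (X T Y : Matrix ι ι K) (r : ι → ℕ), X * Y = 1 ∧ A = X * T * Y ∧ Function.Injective r ∧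
      T.BlockTriangular r := by
  obtain ⟨b, hb⟩ := exists_triangular_basis (K := K) (Fintype.card ι) (V := ι → K)
    (Module.finrank_fintype_fun_eq_card K) (Matrix.toLin' A)
  let e : Fin (Fintype.card ι) ≃ ι := (Fintype.equivFin ι).symm
  let b' := b.reindex e
  let s := Pi.basisFun K ι
  -- The basis gives a lower triangular matrix, whereas `BlockTriangular` asks for zeros where `r j
  -- < r i`; hence the reversal `rev`.
  refine ⟨s.toMatrix b', LinearMap.toMatrix b' b' (Matrix.toLin' A), b'.toMatrix s,
    fun i => (e.symm i).rev, s.toMatrix_mul_toMatrix_flip b', ?_, ?_, ?_⟩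
  · rw [basis_toMatrix_mul_linearMap_toMatrix_mul_basis_toMatrix, LinearMap.toMatrix_eq_toMatrix',
      LinearMap.toMatrix'_toLin']
  · exact Fin.val_injective.comp (Fin.rev_injective.comp e.symm.injective)
  · intro i j hij
    rw [LinearMap.toMatrix_apply]
    simp only [b', Basis.repr_reindex_apply, Basis.reindex_apply]
    exact hb _ _ (Fin.rev_lt_rev.1 hij)

end Triangularization

/-! ### Polynomial class functions on matrices -/

section ClassFunction

open MvPolynomial

/-- Integer points form a product of infinite sets. This carries identities known for integer
matrices over to matrices of indeterminates, and from there to complex matrices. -/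
theorem eq_of_eval_intCast {σ : Type*} (p q : MvPolynomial σ ℚ)
    (h : ∀ a : σ → ℤ, eval (fun i => (a i : ℚ)) p = eval (fun i => (a i : ℚ)) q) : p = q := by
  refine funext_set (fun _ => Set.range (Int.cast : ℤ → ℚ))
    (fun _ => Set.infinite_range_of_injective Int.cast_injective) fun x hx => ?_
  choose a ha using fun i => hx i (Set.mem_univ i)
  have hxa : x = fun i => (a i : ℚ) := funext fun i => (ha i).symm
  rw [hxa, h]

variable {ι : Type*} (p : MvPolynomial (ι × ι) ℚ)

/-- The value of a polynomial at a complex matrix. -/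
def evalMatrix (A : Matrix ι ι ℂ) : ℂ := aeval (fun i => A i.1 i.2) p

theorem evalMatrix_mul_comm [Fintype ι]
    (hp : ∀ A B : Matrix ι ι ℤ, eval (fun i => ((A * B) i.1 i.2 : ℚ)) p =
      eval (fun i => ((B * A) i.1 i.2 : ℚ)) p) (A B : Matrix ι ι ℂ) :
    evalMatrix p (A * B) = evalMatrix p (B * A) := by
  let U : Matrix ι ι (MvPolynomial ((ι × ι) ⊕ (ι × ι)) ℚ) := Matrix.of fun i j => X (.inl (i, j))
  let V : Matrix ι ι (MvPolynomial ((ι × ι) ⊕ (ι × ι)) ℚ) := Matrix.of fun i j => X (.inr (i, j))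
  have h : bind₁ (fun i => (U * V) i.1 i.2) p = bind₁ (fun i => (V * U) i.1 i.2) p := by
    refine eq_of_eval_intCast _ _ fun a => ?_
    have h1 := hp (Matrix.of fun i j => a (.inl (i, j))) (Matrix.of fun i j => a (.inr (i, j)))
    rw [← coe_aeval_eq_eval, ← coe_aeval_eq_eval] at h1
    rw [← coe_aeval_eq_eval]
    simp only [RingHom.coe_coe] at h1 ⊢
    rw [aeval_bind₁, aeval_bind₁]
    simpa [Matrix.mul_apply, U, V] using h1
  have h2 := congrArg (aeval (Sum.elim (fun i => A i.1 i.2) (fun i => B i.1 i.2))) h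
  rw [aeval_bind₁, aeval_bind₁] at h2
  simpa [Matrix.mul_apply, U, V, evalMatrix] using h2

theorem evalMatrix_diagonal [DecidableEq ι]
    (hp : ∀ a : ι → ℤ, eval (fun i => ((Matrix.diagonal a i.1 i.2 : ℤ) : ℚ)) p = 0) (a : ι → ℂ) :
    evalMatrix p (Matrix.diagonal a) = 0 := by
  have h : bind₁ (fun i : ι × ι => Matrix.diagonal (X : ι → MvPolynomial ι ℚ) i.1 i.2) p = 0 := by
    refine eq_of_eval_intCast _ _ fun a => ?_
    have h1 := hp a
    rw [← coe_aeval_eq_eval] at h1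
    rw [← coe_aeval_eq_eval]
    simp only [RingHom.coe_coe] at h1 ⊢
    rw [aeval_bind₁, map_zero]
    simpa [Matrix.diagonal_apply, apply_ite] using h1
  have h2 := congrArg (aeval a) h
  rw [aeval_bind₁, map_zero] at h2
  simpa [Matrix.diagonal_apply, apply_ite, evalMatrix] using h2

variable [Fintype ι] [DecidableEq ι]

/-- Conjugation by `diag(s ^ r i)` multiplies the entry `(i, j)` by `s ^ (r j - r i)` and preserves
the value of `p`. The value is polynomial in `s` and constant for `s ≠ 0`, so `s = 0` is allowed,
where only the diagonal survives. Truncated subtraction is harmless: the entries with `r j < r i`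
vanish. -/
theorem evalMatrix_triangular (hcomm : ∀ A B, evalMatrix p (A * B) = evalMatrix p (B * A))
    (T : Matrix ι ι ℂ) (r : ι → ℕ) (hr : Function.Injective r) (hT : T.BlockTriangular r) :
    evalMatrix p T = evalMatrix p (Matrix.diagonal fun i => T i i) := by
  let G : Polynomial ℂ := aeval (fun i : ι × ι =>
    Polynomial.C (T i.1 i.2) * Polynomial.X ^ (r i.2 - r i.1)) p
  have hG : ∀ s, G.eval s = evalMatrix p (Matrix.of fun i j => T i j * s ^ (r j - r i)) := by
    intro s
    have h1 := congrArg (fun φ : MvPolynomial (ι × ι) ℚ →ₐ[ℚ] ℂ => φ p)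
      (comp_aeval (fun i : ι × ι => Polynomial.C (T i.1 i.2) * Polynomial.X ^ (r i.2 - r i.1))
        ((Polynomial.aeval s : Polynomial ℂ →ₐ[ℂ] ℂ).restrictScalars ℚ))
    simpa [G, evalMatrix, Polynomial.aeval_def] using h1
  have hs : ∀ s ≠ 0, G.eval s = evalMatrix p T := by
    intro s hs
    have h1 : (Matrix.of fun i j => T i j * s ^ (r j - r i)) =
        Matrix.diagonal (fun i => (s ^ r i)⁻¹) * (T * Matrix.diagonal (fun i => s ^ r i)) := by
      ext i j
      rw [Matrix.diagonal_mul, Matrix.mul_diagonal, Matrix.of_apply]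
      rcases lt_or_ge (r j) (r i) with h | h
      · rw [hT h]
        simp
      · rw [pow_sub₀ _ hs h]
        ring
    rw [hG, h1, hcomm, mul_assoc, Matrix.diagonal_mul_diagonal]
    have h2 : (fun i => s ^ r i * (s ^ r i)⁻¹) = 1 := by
      funext i
      exact mul_inv_cancel₀ (pow_ne_zero _ hs)
    rw [h2]
    simp
  have hconst : G = Polynomial.C (evalMatrix p T) := by
    refine Polynomial.eq_of_infinite_eval_eq _ _
      (((Set.finite_singleton (0 : ℂ)).infinite_compl).mono fun s hs' => ?_)
    rw [Set.mem_ofPred_eq, hs s hs', Polynomial.eval_C]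
  have h0 := hG 0
  rw [hconst, Polynomial.eval_C] at h0
  rw [h0]
  congr 1
  ext i j
  rw [Matrix.of_apply, Matrix.diagonal_apply]
  split_ifs with hij
  · subst hij
    simp
  · rcases lt_trichotomy (r j) (r i) with h | h | h
    · rw [hT h, zero_mul]
    · exact absurd (hr h).symm hij
    · rw [zero_pow (by omega), mul_zero]

/-- A polynomial class function on integer matrices which vanishes on diagonal matrices is zero. -/
theorem eval_eq_zero_of_diagonal
    (hcomm : ∀ A B : Matrix ι ι ℤ, eval (fun i => ((A * B) i.1 i.2 : ℚ)) p =
      eval (fun i => ((B * A) i.1 i.2 : ℚ)) p)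
    (hdiag : ∀ a : ι → ℤ, eval (fun i => ((Matrix.diagonal a i.1 i.2 : ℤ) : ℚ)) p = 0)
    (A : Matrix ι ι ℤ) : eval (fun i => (A i.1 i.2 : ℚ)) p = 0 := by
  obtain ⟨U, T, V, r, hUV, hA, hr, hT⟩ := exists_triangularization (A.map (Int.cast : ℤ → ℂ))
  have hc := evalMatrix_mul_comm p hcomm
  have h : evalMatrix p (A.map (Int.cast : ℤ → ℂ)) = 0 := by
    rw [hA, hc, ← mul_assoc, mul_eq_one_comm.1 hUV, one_mul, evalMatrix_triangular p hc T r hr hT,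
      evalMatrix_diagonal p hdiag]
  have h2 : evalMatrix p (A.map (Int.cast : ℤ → ℂ)) =
      algebraMap ℚ ℂ (eval (fun i => (A i.1 i.2 : ℚ)) p) := by
    rw [evalMatrix, ← coe_aeval_eq_eval, RingHom.coe_coe, ← aeval_algebraMap_apply]
    refine congrArg (fun g => aeval g p) (funext fun i => ?_)
    simp
  rw [h2] at h
  exact (map_eq_zero _).1 h

end ClassFunction

/-- The Lefschetz number of the endomorphism of a torus with matrix `A` is `det (1 - A)`. -/
theorem lefschetzNumber_matrixMap {ι : Type u} [Fintype ι] [DecidableEq ι] (A : Matrix ι ι ℤ) :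
    lefschetzNumber (matrixMap A) = ((1 - A).det : ℚ) := by
  obtain ⟨p, hp⟩ := exists_mvPolynomial_lefschetzNumber_matrixMap ι
  let q : MvPolynomial (ι × ι) ℚ := (1 - (Matrix.of fun i j => MvPolynomial.X (i, j) :
    Matrix ι ι (MvPolynomial (ι × ι) ℚ))).det
  have hq : ∀ A : Matrix ι ι ℤ, MvPolynomial.eval (fun i => (A i.1 i.2 : ℚ)) q =
      ((1 - A).det : ℚ) := fun A => by
    rw [RingHom.map_det, Int.cast_det]
    congr 1
    ext i j
    simp [Matrix.one_apply, apply_ite]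
  have h := eval_eq_zero_of_diagonal (p - q)
    (fun A B => by
      rw [map_sub, map_sub, hq, hq, ← hp, ← hp, lefschetzNumber_matrixMap_mul_comm,
        Matrix.det_one_sub_mul_comm])
    (fun a => by
      rw [map_sub, hq, ← hp, matrixMap_diagonal, lefschetzNumber_diagonalMap, ← Matrix.diagonal_one,
        Matrix.diagonal_sub, Matrix.det_diagonal]
      simp) A
  rw [map_sub, hq, ← hp, sub_eq_zero] at h
  exact h

/-! ### Products with a finite discrete space -/

section DiscreteProduct

open Simplicial

/-- The part of a chain map induced by a map of simplicial sets on the simplices selected by a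
labelling that is constant along faces. -/
def selectedChainMap {C : Type*} [Category* C] [Preadditive C] [Limits.HasCoproducts.{u} C] (R : C)
    {K L : SSet.{u}} (p : K ⟶ L) (S : ∀ n : ℕ, K _⦋n⦌ → Prop)
    (hS : ∀ n (i : Fin (n + 2)) (x : K _⦋n + 1⦌), S n (K.δ i x) ↔ S (n + 1) x) :
    K.chainComplex R ⟶ L.chainComplex R where
  f n := open scoped Classical in
    chainDesc R K fun x => if S n x then L.ιChainComplex (p.app _ x) else 0
  comm' := by
    rintro _ n rfl
    refine SSet.chainComplex_hom_ext fun x => ?_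
    rw [← Category.assoc, ι_chainDesc, SSet.ιChainComplex_d_assoc, Preadditive.sum_comp]
    simp only [Preadditive.zsmul_comp, ι_chainDesc]
    by_cases h : S (n + 1) x
    · rw [if_pos h, SSet.ιChainComplex_d]
      refine Finset.sum_congr rfl fun i _ => ?_
      rw [if_pos ((hS n i x).2 h), SSet.δ_naturality_apply]
    · rw [if_neg h, Limits.zero_comp]
      refine (Finset.sum_eq_zero fun i _ => ?_).symm
      rw [if_neg fun h' => h ((hS n i x).1 h'), smul_zero]

open scoped Classical in
theorem ι_selectedChainMap {C : Type*} [Category* C] [Preadditive C] [Limits.HasCoproducts.{u} C]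
    (R : C) {K L : SSet.{u}} (p : K ⟶ L) (S : ∀ n : ℕ, K _⦋n⦌ → Prop)
    (hS : ∀ n (i : Fin (n + 2)) (x : K _⦋n + 1⦌), S n (K.δ i x) ↔ S (n + 1) x) (n : ℕ)
    (x : K _⦋n⦌) : K.ιChainComplex x ≫ (selectedChainMap R p S hS).f n =
      if S n x then L.ιChainComplex (p.app _ x) else 0 :=
  ι_chainDesc R K _ x

variable (X D : Type u) [TopologicalSpace X] [TopologicalSpace D] [DiscreteTopology D]

/-- The label of a singular simplex of `X × D`. -/
def simplexLabel (n : SimplexCategoryᵒᵖ) (x : (TopCat.toSSet.obj (TopCat.of (X × D))).obj n) : D :=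
  (TopCat.toSSetIsoConst (TopCat.of D)).hom.app n
    ((TopCat.toSSet.map (TopCat.ofHom (ContinuousMap.snd : C(X × D, D)))).app n x)

theorem simplexLabel_map {m n : SimplexCategoryᵒᵖ} (f : m ⟶ n) (x) :
    simplexLabel X D n ((TopCat.toSSet.obj (TopCat.of (X × D))).map f x) =
      simplexLabel X D m x := by
  have h := (TopCat.toSSet.map (TopCat.ofHom (ContinuousMap.snd : C(X × D, D))) ≫
    (TopCat.toSSetIsoConst (TopCat.of D)).hom).naturality f
  exact congrArg (fun g => g x) h

/-- Every singular simplex of a discrete space is constant, so one label describes the whole second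
coordinate. -/
theorem snd_simplex (n : SimplexCategoryᵒᵖ) (x) (a) :
    ((TopCat.of (X × D)).toSSetObjEquiv n x a).2 = simplexLabel X D n x := by
  have h := congrArg (fun g => (TopCat.of D).toSSetObjEquiv n (g.app n
    ((TopCat.toSSet.map (TopCat.ofHom (ContinuousMap.snd : C(X × D, D)))).app n x)) a)
    (TopCat.toSSetIsoConst (TopCat.of D)).hom_inv_id
  exact h.symm

variable {D} in
/-- The component of label `c` of a chain of `X × D`. -/
def componentChainMap (c : D) : rationalChains (X × D) ⟶ rationalChains X :=
  selectedChainMap _ (TopCat.toSSet.map (TopCat.ofHom (ContinuousMap.fst : C(X × D, X))))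
    (fun _ x => simplexLabel X D _ x = c)
    (fun _ i x => by rw [← simplexLabel_map X D (SimplexCategory.δ i).op x]; rfl)

variable {D} in
/-- The inclusion of a component of `X × D`. -/
def inclComponent (c : D) : C(X, X × D) := ⟨fun x => (x, c), by fun_prop⟩

variable {X D}

theorem simplexLabel_inclComponent (c : D) (n : SimplexCategoryᵒᵖ)
    (x : (TopCat.toSSet.obj (TopCat.of X)).obj n) :
    simplexLabel X D n ((TopCat.toSSet.map (TopCat.ofHom (inclComponent X c))).app n x) = c := by
  obtain ⟨a⟩ : Nonempty (stdSimplex ℝ (Fin (n.unop.len + 1))) := inferInstance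
  exact (snd_simplex X D n _ a).symm

theorem inclComponent_fst (n : SimplexCategoryᵒᵖ)
    (x : (TopCat.toSSet.obj (TopCat.of (X × D))).obj n) :
    (TopCat.toSSet.map (TopCat.ofHom (inclComponent X (simplexLabel X D n x)))).app n
      ((TopCat.toSSet.map (TopCat.ofHom (ContinuousMap.fst : C(X × D, X)))).app n x) = x := by
  apply ((TopCat.of (X × D)).toSSetObjEquiv n).injective
  ext1 a
  exact Prod.ext rfl (snd_simplex X D n x a).symm

theorem inclComponent_comp_componentChainMap [DecidableEq D] (c c' : D) :
    rationalChainsMap (inclComponent X c) ≫ componentChainMap X c' =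
      if c = c' then 𝟙 _ else 0 := by
  ext1 n
  refine SSet.chainComplex_hom_ext fun x => ?_
  rw [HomologicalComplex.comp_f, SSet.ι_chainComplexMap_f_assoc, componentChainMap,
    ι_selectedChainMap, simplexLabel_inclComponent]
  split_ifs with h
  · rw [HomologicalComplex.id_f, Category.comp_id]
    rfl
  · rw [HomologicalComplex.zero_f, Limits.comp_zero]

theorem sum_componentChainMap_comp_inclComponent [Fintype D] :
    ∑ c : D, componentChainMap X c ≫ rationalChainsMap (inclComponent X c) = 𝟙 _ := by
  classical
  ext1 n
  refine SSet.chainComplex_hom_ext fun x => ?_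
  have hsum : (∑ c : D, componentChainMap X c ≫ rationalChainsMap (inclComponent X c)).f n =
      ∑ c : D, (componentChainMap X c ≫ rationalChainsMap (inclComponent X c)).f n :=
    map_sum (HomologicalComplex.Hom.fAddMonoidHom n) _ _
  rw [hsum, Preadditive.comp_sum,
    Finset.sum_eq_single (simplexLabel X D _ x)]
  · rw [HomologicalComplex.comp_f, ← Category.assoc, componentChainMap, ι_selectedChainMap,
      if_pos rfl, SSet.ι_chainComplexMap_f, inclComponent_fst, HomologicalComplex.id_f,
      Category.comp_id]
  · intro c _ hc
    rw [HomologicalComplex.comp_f, ← Category.assoc, componentChainMap, ι_selectedChainMap,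
      if_neg (Ne.symm hc), Limits.zero_comp]
  · intro h
    exact absurd (Finset.mem_univ _) h

variable (X) in
/-- The component of label `c` of a homology class of `X × D`. -/
def homologyComponent (k : ℕ) (c : D) : rationalHomology k (X × D) →ₗ[ℚ] rationalHomology k X :=
  (HomologicalComplex.homologyMap (componentChainMap X c) k).hom

theorem homologyComponent_comp_hmap [DecidableEq D] (k : ℕ) (c c' : D) :
    homologyComponent X k c' ∘ₗ hmap k (inclComponent X c) =
      if c = c' then LinearMap.id else 0 := by
  have h := congrArg (fun φ : rationalChains X ⟶ rationalChains X =>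
    (HomologicalComplex.homologyMap φ k).hom) (inclComponent_comp_componentChainMap (X := X) c c')
  refine Eq.trans ?_ (h.trans ?_)
  · rw [HomologicalComplex.homologyMap_comp]
    rfl
  split_ifs
  · rw [HomologicalComplex.homologyMap_id]
    rfl
  · rw [HomologicalComplex.homologyMap_zero]
    rfl

theorem sum_hmap_comp_homologyComponent [Fintype D] (k : ℕ) :
    ∑ c : D, hmap k (inclComponent X c) ∘ₗ homologyComponent X k c = LinearMap.id := by
  have h := congrArg (HomologicalComplex.homologyFunctor (ModuleCat.{u} ℚ)
    (ComplexShape.down ℕ) k).map (sum_componentChainMap_comp_inclComponent (X := X) (D := D))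
  rw [Functor.map_sum, CategoryTheory.Functor.map_id] at h
  have h2 := congrArg ModuleCat.Hom.hom h
  rw [ModuleCat.hom_sum] at h2
  refine Eq.trans (Finset.sum_congr rfl fun c _ => ?_) h2
  rw [CategoryTheory.Functor.map_comp]
  rfl

theorem FiniteHomology.prod_discrete [Finite D] {d : ℕ} (h : FiniteHomology d X) :
    FiniteHomology d (X × D) := by
  have := Fintype.ofFinite D
  have hy : ∀ k (y : rationalHomology k (X × D)),
      ∑ c : D, hmap k (inclComponent X c) (homologyComponent X k c y) = y := fun k y => by
    simpa using LinearMap.congr_fun (sum_hmap_comp_homologyComponent (X := X) (D := D) k) y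
  refine ⟨fun k => ?_, fun k hk => ?_⟩
  · have := h.finite k
    refine Module.Finite.of_surjective (∑ c : D, hmap k (inclComponent X c) ∘ₗ
      (LinearMap.proj c : (D → rationalHomology k X) →ₗ[ℚ] rationalHomology k X)) fun y =>
        ⟨fun c => homologyComponent X k c y, ?_⟩
    simpa using hy k y
  · have := h.subsingleton k hk
    refine ⟨fun y z => ?_⟩
    rw [← hy k y, ← hy k z]
    exact Finset.sum_congr rfl fun c _ => congrArg _ (Subsingleton.elim _ _)

/-- A self-map of `X × D` that permutes the components through `s`, and is homotopic to `g` on each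
component, has Lefschetz number `#Fix(s) · L(g)`. -/
theorem lefschetzNumber_prod_discrete [Finite D] {d : ℕ} (h : FiniteHomology d X)
    (f : C(X × D, X × D)) (s : D → D) (hs : ∀ z, (f z).2 = s z.2) (g : C(X, X))
    (hg : ∀ c, (ContinuousMap.fst.comp (f.comp (inclComponent X c))).Homotopic g) :
    lefschetzNumber f = Nat.card {c // s c = c} * lefschetzNumber g := by
  classical
  have := Fintype.ofFinite D
  rw [h.prod_discrete.lefschetzNumber_eq f (Nat.lt_succ_self d),
    h.lefschetzNumber_eq g (Nat.lt_succ_self d), Finset.mul_sum]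
  refine Finset.sum_congr rfl fun k _ => ?_
  rw [mul_left_comm]
  congr 1
  have := h.finite k
  have := h.prod_discrete (D := D).finite k
  have hc : ∀ c, hmap k f ∘ₗ hmap k (inclComponent X c) =
      hmap k (inclComponent X (s c)) ∘ₗ hmap k g := fun c => by
    rw [← hmap_eq_of_homotopic k (hg c), ← hmap_comp, ← hmap_comp]
    congr 1
    ext1 x
    exact Prod.ext rfl (hs (x, c))
  -- Insert the decomposition of the identity into components. Cyclicity of the trace brings the
  -- projection to `c` in front of the inclusion of `s c`, so only fixed labels contribute.
  calc LinearMap.trace ℚ _ (hmap k f)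
      = ∑ c : D, LinearMap.trace ℚ _
          (hmap k f ∘ₗ hmap k (inclComponent X c) ∘ₗ homologyComponent X k c) := by
        rw [← map_sum]
        congr 1
        ext1 y
        have hy := LinearMap.congr_fun (sum_hmap_comp_homologyComponent (X := X) (D := D) k) y
        simp only [LinearMap.sum_apply, LinearMap.comp_apply, LinearMap.id_apply] at hy ⊢
        rw [← map_sum, hy]
    _ = ∑ c : D, if s c = c then LinearMap.trace ℚ _ (hmap k g) else 0 := by
        refine Finset.sum_congr rfl fun c _ => ?_
        rw [← LinearMap.comp_assoc, hc, LinearMap.trace_comp_comm', ← LinearMap.comp_assoc,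
          homologyComponent_comp_hmap]
        split_ifs
        · rw [LinearMap.id_comp]
        · rw [LinearMap.zero_comp, map_zero]
    _ = _ := by
        rw [← Finset.sum_filter, Finset.sum_const, nsmul_eq_mul, Nat.card_eq_fintype_card,
          Fintype.card_subtype]

end DiscreteProduct

/-! ### The Pontryagin dual of a finitely generated abelian group -/

section Dual

open Module

theorem finite_torsion (G : Type u) [CommGroup G] [Group.FG G] : Finite (CommGroup.torsion G) := by
  have : Module.Finite ℤ (Additive G) := Module.Finite.iff_addGroup_fg.2 inferInstance
  let N : Submodule ℤ (Additive G) :=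
    AddSubgroup.toIntSubmodule (Subgroup.toAddSubgroup (CommGroup.torsion G))
  have hN : Finite N := by
    refine Module.finite_of_fg_torsion N fun x => ?_
    obtain ⟨n, hn, hx⟩ := isOfFinOrder_iff_pow_eq_one.1 x.2
    refine ⟨⟨(n : ℤ), mem_nonZeroDivisors_of_ne_zero (by exact_mod_cast hn.ne')⟩, ?_⟩
    apply Subtype.ext
    change (n : ℤ) • (x : Additive G) = 0
    rw [natCast_zsmul]
    exact hx
  exact hN

/-- The projection of `G` to its torsion-free quotient. -/
def freePartMk (G : Type u) [CommGroup G] : Additive G →ₗ[ℤ] FreePart G :=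
  (MonoidHom.toAdditive (QuotientGroup.mk' (CommGroup.torsion G))).toIntLinearMap

theorem freePartMk_eq_zero_iff {G : Type u} [CommGroup G] (x : G) :
    freePartMk G (Additive.ofMul x) = 0 ↔ x ∈ CommGroup.torsion G :=
  QuotientGroup.eq_one_iff x

theorem freePartMk_surjective (G : Type u) [CommGroup G] : Function.Surjective (freePartMk G) :=
  QuotientGroup.mk'_surjective (CommGroup.torsion G)

theorem freePartMap_mk {G : Type u} [CommGroup G] (φ : Monoid.End G) (x : G) :
    freePartMap φ (freePartMk G (Additive.ofMul x)) = freePartMk G (Additive.ofMul (φ x)) :=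
  rfl

/-- A splitting of an abelian group as the product of its torsion subgroup and a free group. -/
structure FreeSplitting (G : Type u) [CommGroup G] (ι : Type u) [Fintype ι] where
  /-- a basis of the torsion-free quotient -/
  basis : Basis ι ℤ (FreePart G)
  /-- lifts of the basis -/
  gen : ι → G
  /-- the projection to the torsion subgroup -/
  proj : G →* CommGroup.torsion G
  mk_gen : ∀ i, freePartMk G (Additive.ofMul (gen i)) = basis i
  proj_coe : ∀ t : CommGroup.torsion G, proj t = t
  proj_gen : ∀ i, proj (gen i) = 1
  eq_mul_prod : ∀ x : G,
    x = proj x * ∏ i, gen i ^ basis.repr (freePartMk G (Additive.ofMul x)) i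

/-- The free quotient is projective, so the projection has a section `s`; the torsion component of
`x` is `x - s [x]`. -/
theorem exists_freeSplitting (G : Type u) [CommGroup G] [Group.FG G] (ι : Type u) [Fintype ι]
    (b : Basis ι ℤ (FreePart G)) : ∃ S : FreeSplitting G ι, S.basis = b := by
  obtain ⟨s, hs⟩ := Module.projective_lifting_property (freePartMk G) LinearMap.id
    (freePartMk_surjective G)
  have hs' : ∀ y, freePartMk G (s y) = y := fun y => LinearMap.congr_fun hs y
  let f : Additive G →+ Additive G := AddMonoidHom.id _ - (s ∘ₗ freePartMk G).toAddMonoidHom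
  have hf : ∀ x : Additive G, f x = x - s (freePartMk G x) := fun _ => rfl
  let τ : G →* CommGroup.torsion G := (AddMonoidHom.toMultiplicative f).codRestrict _ fun x => by
    refine (freePartMk_eq_zero_iff _).1 ?_
    change freePartMk G (f (Additive.ofMul x)) = 0
    rw [hf, map_sub, hs', sub_self]
  have hτ : ∀ x, (τ x : G) = (f (Additive.ofMul x)).toMul := fun _ => rfl
  refine ⟨⟨b, fun i => (s (b i)).toMul, τ, fun i => hs' _, fun t => ?_, fun i => ?_, fun x => ?_⟩,
    rfl⟩
  · apply Subtype.ext
    rw [hτ, hf, (freePartMk_eq_zero_iff _).2 t.2, map_zero, sub_zero]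
    rfl
  · apply Subtype.ext
    rw [hτ, hf]
    change (s (b i) - s (freePartMk G (s (b i)))).toMul = 1
    rw [hs', sub_self]
    rfl
  · have h : s (freePartMk G (Additive.ofMul x)) =
        ∑ i, b.repr (freePartMk G (Additive.ofMul x)) i • s (b i) := by
      conv_lhs => rw [← b.sum_repr (freePartMk G (Additive.ofMul x)), map_sum]
      simp only [map_smul]
    have h2 : Additive.ofMul x = f (Additive.ofMul x) +
        ∑ i, b.repr (freePartMk G (Additive.ofMul x)) i • s (b i) := by
      rw [← h, hf, sub_add_cancel]
    exact h2

variable {G : Type u} [CommGroup G] [TopologicalSpace G] [DiscreteTopology G]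
  {ι : Type u} [Fintype ι] (S : FreeSplitting G ι)

/-- The character of `G` with given values on the free generators and on the torsion subgroup. -/
def FreeSplitting.character (z : (ι → Circle) × PontryaginDual (CommGroup.torsion G)) :
    PontryaginDual G :=
  (⟨⟨⟨fun y => (∏ i, z.1 i ^ S.basis.repr (freePartMk G (Additive.ofMul y)) i) * z.2 (S.proj y),
    by simp⟩, fun y y' => by
      simp only [ofMul_mul, map_add, Finsupp.add_apply, zpow_add, Finset.prod_mul_distrib, map_mul]
      exact mul_mul_mul_comm _ _ _ _⟩, continuous_of_discreteTopology⟩ : G →ₜ* Circle)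

theorem FreeSplitting.character_apply
    (z : (ι → Circle) × PontryaginDual (CommGroup.torsion G)) (y : G) : S.character z y =
      (∏ i, z.1 i ^ S.basis.repr (freePartMk G (Additive.ofMul y)) i) * z.2 (S.proj y) :=
  rfl

/-- The restriction of a character to the torsion subgroup. -/
def torsionRestrict (χ : PontryaginDual G) : PontryaginDual (CommGroup.torsion G) :=
  PontryaginDual.map (⟨(CommGroup.torsion G).subtype, continuous_of_discreteTopology⟩ :
    CommGroup.torsion G →ₜ* G) χ

theorem torsionRestrict_apply (χ : PontryaginDual G) (t : CommGroup.torsion G) :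
    torsionRestrict χ t = χ t :=
  rfl

theorem continuous_torsionRestrict : Continuous (torsionRestrict (G := G)) :=
  (PontryaginDual.map (⟨(CommGroup.torsion G).subtype, continuous_of_discreteTopology⟩ :
    CommGroup.torsion G →ₜ* G)).continuous_toFun

theorem continuous_pontryaginDual_apply {A : Type*} [Monoid A] [TopologicalSpace A] (a : A) :
    Continuous fun χ : PontryaginDual A => χ a :=
  ContinuousEvalConst.continuous_eval_const (F := A →ₜ* Circle) a

/-- The Pontryagin dual as the product of a torus and the dual of the torsion subgroup. -/
def FreeSplitting.dualHomeomorph :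
    PontryaginDual G ≃ₜ (ι → Circle) × PontryaginDual (CommGroup.torsion G) where
  toFun χ := (fun i => χ (S.gen i), torsionRestrict χ)
  invFun := S.character
  left_inv χ := by
    refine PontryaginDual.ext fun y => ?_
    rw [S.character_apply, torsionRestrict_apply]
    conv_rhs => rw [S.eq_mul_prod y]
    simp only [map_mul, map_prod, map_zpow]
    rw [mul_comm]
  right_inv z := by
    classical
    refine Prod.ext (funext fun i => ?_) (PontryaginDual.ext fun t => ?_)
    · simp only
      rw [S.character_apply, S.mk_gen, S.proj_gen, map_one, mul_one, S.basis.repr_self,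
        Finset.prod_eq_single i]
      · simp
      · intro j _ hj
        rw [Finsupp.single_eq_of_ne hj, zpow_zero]
      · intro h
        exact absurd (Finset.mem_univ i) h
    · simp only
      rw [torsionRestrict_apply, S.character_apply, S.proj_coe, (freePartMk_eq_zero_iff _).2 t.2]
      simp
  continuous_toFun :=
    (continuous_pi fun i => continuous_pontryaginDual_apply _).prodMk continuous_torsionRestrict
  continuous_invFun := by
    -- Continuity into the compact-open topology follows from joint continuity in `(z, y)`; as `G`
    -- is discrete, this is checked for each `y` separately.
    refine ContinuousMonoidHom.continuous_of_continuous_uncurry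
      (fun z => (S.character z : G →ₜ* Circle)) ?_
    refine continuous_prod_of_discrete_right.2 fun y => ?_
    change Continuous fun z : (ι → Circle) × PontryaginDual (CommGroup.torsion G) =>
      (∏ i, z.1 i ^ S.basis.repr (freePartMk G (Additive.ofMul y)) i) * z.2 (S.proj y)
    refine Continuous.mul ?_ ((continuous_pontryaginDual_apply (S.proj y)).comp continuous_snd)
    exact continuous_finsetProd _ fun i _ =>
      ((continuous_apply i).comp continuous_fst).zpow _

theorem dualMap_apply (φ : Monoid.End G) (χ : PontryaginDual G) (y : G) :
    dualMap φ χ y = χ (φ y) :=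
  rfl

theorem iterateMap_dualMap (φ : Monoid.End G) (n : ℕ) :
    iterateMap (dualMap φ) n = dualMap (φ ^ n) := by
  ext1 χ
  refine PontryaginDual.ext fun y => ?_
  rw [dualMap_apply]
  change ((dualMap φ)^[n] χ) y = _
  induction n generalizing χ with
  | zero => rfl
  | succ n ih => rw [Function.iterate_succ_apply, ih, dualMap_apply, pow_succ']; rfl

/-- The endomorphism induced on the torsion subgroup. -/
def torsionMap {G : Type u} [CommGroup G] (φ : Monoid.End G) :
    Monoid.End (CommGroup.torsion G) :=
  ((φ : G →* G).comp (CommGroup.torsion G).subtype).codRestrict _ fun x =>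
    MonoidHom.isOfFinOrder (φ : G →* G) x.2

theorem torsionMap_coe {G : Type u} [CommGroup G] (φ : Monoid.End G) (t : CommGroup.torsion G) :
    (torsionMap φ t : G) = φ t :=
  rfl

/-- Translation by a constant on a torus does not change the homotopy class of a map. -/
theorem homotopic_mul_const {X : Type u} [TopologicalSpace X] {κ : Type u}
    (f g : C(X, κ → Circle)) (c : κ → Circle) (h : ∀ x i, f x i = g x i * c i) :
    f.Homotopic g := by
  refine ⟨⟨⟨fun p i => g p.2 i * Circle.exp ((1 - (p.1 : ℝ)) * Complex.arg (c i)), ?_⟩, ?_, ?_⟩⟩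
  · refine continuous_pi fun i => ?_
    fun_prop
  · intro x
    funext i
    simp [h]
  · intro x
    funext i
    simp

/-- The matrix of `φ` on the torsion-free quotient, acting on rows. -/
def FreeSplitting.rowMatrix (φ : Monoid.End G) : Matrix ι ι ℤ :=
  fun i j => S.basis.repr (freePartMk G (Additive.ofMul (φ (S.gen i)))) j

theorem FreeSplitting.rowMatrix_eq {G : Type u} [CommGroup G] {ι : Type u} [Fintype ι]
    [DecidableEq ι] (S : FreeSplitting G ι) (φ : Monoid.End G) :
    S.rowMatrix φ = (LinearMap.toMatrix S.basis S.basis (freePartMap φ)).transpose := by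
  ext i j
  rw [Matrix.transpose_apply, LinearMap.toMatrix_apply, ← S.mk_gen, freePartMap_mk]
  rfl

theorem FreeSplitting.det_one_sub_rowMatrix {G : Type u} [CommGroup G] {ι : Type u} [Fintype ι]
    [DecidableEq ι] (S : FreeSplitting G ι) (φ : Monoid.End G) :
    (1 - S.rowMatrix φ).det = LinearMap.det (1 - freePartMap φ) := by
  rw [S.rowMatrix_eq, ← LinearMap.det_toMatrix S.basis, map_sub, LinearMap.toMatrix_one,
    ← Matrix.det_transpose, Matrix.transpose_sub, Matrix.transpose_one, Matrix.transpose_transpose]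

theorem finiteHomology_pontryaginDual [Group.FG G] :
    FiniteHomology (Module.finrank ℤ (FreePart G)) (PontryaginDual G) := by
  classical
  obtain ⟨S, -⟩ := exists_freeSplitting G _ (Module.Free.chooseBasis ℤ (FreePart G))
  have := finite_torsion G
  have : Finite (PontryaginDual (CommGroup.torsion G)) := finite_of_compact_of_discrete
  rw [Module.finrank_eq_card_chooseBasisIndex]
  exact ((torus_finiteHomology _).prod_discrete
    (D := PontryaginDual (CommGroup.torsion G))).homeomorph S.dualHomeomorph.symm

/-- On the component labelled `c`, the torus coordinate of the dual map is `matrixMap` of the row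
matrix times the constants `c (proj (φ (gen i)))`, which a homotopy removes. The row matrix is a
transpose, which leaves the determinant unchanged. -/
theorem lefschetzNumber_dualMap [Group.FG G] (φ : Monoid.End G) :
    lefschetzNumber (dualMap φ) =
      Nat.card {ψ : PontryaginDual (CommGroup.torsion G) // dualMap (torsionMap φ) ψ = ψ} *
        ((LinearMap.det (1 - freePartMap φ) : ℤ) : ℚ) := by
  classical
  obtain ⟨S, -⟩ := exists_freeSplitting G _ (Module.Free.chooseBasis ℤ (FreePart G))
  have := finite_torsion G
  have : Finite (PontryaginDual (CommGroup.torsion G)) := finite_of_compact_of_discrete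
  let e := S.dualHomeomorph
  let F := (ContinuousMap.mk e e.continuous).comp
    ((dualMap φ).comp (ContinuousMap.mk e.symm e.symm.continuous))
  have hF : ∀ z, F z = e (dualMap φ (S.character z)) := fun _ => rfl
  rw [lefschetzNumber_conj e (dualMap φ) F fun χ => by
    change _ = e (dualMap φ (e.symm (e χ)))
    rw [e.symm_apply_apply]]
  rw [lefschetzNumber_prod_discrete (torus_finiteHomology _) F (dualMap (torsionMap φ)) ?_
    (matrixMap (S.rowMatrix φ)) ?_, lefschetzNumber_matrixMap, S.det_one_sub_rowMatrix]
  · intro z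
    refine PontryaginDual.ext fun t => ?_
    change S.character z (φ t) = z.2 (torsionMap φ t)
    rw [← torsionMap_coe, S.character_apply, S.proj_coe,
      (freePartMk_eq_zero_iff _).2 (Subtype.prop _)]
    simp
  · intro c
    refine homotopic_mul_const _ _ (fun i => c (S.proj (φ (S.gen i)))) fun x i => ?_
    change S.character (x, c) (φ (S.gen i)) = _
    rw [S.character_apply]
    rfl

end Dual

/-! ### Reidemeister numbers as indices -/

section Index

open Module

/-- The index of the image of an endomorphism of a free abelian group with non-zero determinant. -/
theorem index_range_eq_natAbs_det {E : Type*} [AddCommGroup E] [Module.Free ℤ E]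
    [Module.Finite ℤ E] (f : E →ₗ[ℤ] E) (hf : Function.Injective f) :
    f.range.toAddSubgroup.index = (LinearMap.det f).natAbs := by
  have h := Submodule.natAbs_det_equiv f.range (LinearEquiv.ofInjective f hf)
  have h2 : f.range.subtype ∘ₗ ((LinearEquiv.ofInjective f hf : E ≃+ f.range) :
      E →+ f.range).toIntLinearMap = f := rfl
  exact h.symm.trans (congrArg (fun g => (LinearMap.det g).natAbs) h2)

/-- A finite index `m` annihilates the cokernel, so `f ∘ g = m` for some `g`, and `det f · det g` is
a power of `m ≠ 0`. An infinite index has the value `0`. -/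
theorem det_ne_zero_of_index_range_ne_zero {E : Type*} [AddCommGroup E] [Module.Free ℤ E]
    [Module.Finite ℤ E] (f : E →ₗ[ℤ] E) (h : f.range.toAddSubgroup.index ≠ 0) :
    LinearMap.det f ≠ 0 := by
  set m := f.range.toAddSubgroup.index
  have hm : ∀ x, ∃ y, f y = m • x := fun x => f.range.toAddSubgroup.nsmul_index_mem x
  let b := Free.chooseBasis ℤ E
  choose g hg using fun i => hm (b i)
  have hfg : f ∘ₗ b.constr ℤ g = (m : ℤ) • LinearMap.id := by
    refine b.ext fun i => ?_
    simp [hg]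
  have hd := congrArg LinearMap.det hfg
  rw [LinearMap.det_comp, LinearMap.det_smul, LinearMap.det_id, mul_one] at hd
  intro h0
  rw [h0, zero_mul] at hd
  exact pow_ne_zero _ (by exact_mod_cast h) hd.symm

/-- The homomorphism `x ↦ x φ(x)⁻¹`. -/
def twist {G : Type u} [CommGroup G] (φ : Monoid.End G) : G →* G where
  toFun x := x / φ x
  map_one' := by simp
  map_mul' x y := by rw [map_mul, mul_div_mul_comm]

theorem twist_apply {G : Type u} [CommGroup G] (φ : Monoid.End G) (x : G) :
    twist φ x = x / φ x :=
  rfl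

theorem reidemeisterNumber_eq {G : Type u} [CommGroup G] (φ : Monoid.End G) :
    reidemeisterNumber φ = ENat.card (G ⧸ (twist φ).range) := by
  have h : twistedConjSetoid φ = QuotientGroup.leftRel (twist φ).range := by
    ext α α'
    rw [QuotientGroup.leftRel_apply]
    refine exists_congr fun γ => ?_
    rw [twist_apply, eq_inv_mul_iff_mul_eq, eq_comm, div_eq_mul_inv, mul_left_comm, mul_assoc]
  unfold reidemeisterNumber
  rw [h]
  rfl

theorem toNat_reidemeisterNumber {G : Type u} [CommGroup G] (φ : Monoid.End G) :
    (reidemeisterNumber φ).toNat = (twist φ).range.index := by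
  rw [reidemeisterNumber_eq]
  rfl

theorem reidemeisterNumber_ne_top_iff {G : Type u} [CommGroup G] (φ : Monoid.End G) :
    reidemeisterNumber φ ≠ ⊤ ↔ (twist φ).range.index ≠ 0 := by
  rw [reidemeisterNumber_eq, Subgroup.index_ne_zero_iff_finite, Ne, ENat.card_eq_top,
    not_infinite_iff_finite]

theorem map_range_twist {G : Type u} [CommGroup G] (φ : Monoid.End G) :
    (((twist φ).range.map (QuotientGroup.mk' (CommGroup.torsion G))).toAddSubgroup :
      AddSubgroup (FreePart G)) = (1 - freePartMap φ).range.toAddSubgroup := by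
  ext y
  constructor
  · rintro ⟨_, ⟨x, rfl⟩, rfl⟩
    exact ⟨freePartMk G (Additive.ofMul x), rfl⟩
  · rintro ⟨x, rfl⟩
    obtain ⟨x, rfl⟩ := freePartMk_surjective G x
    exact ⟨_, ⟨x.toMul, rfl⟩, rfl⟩

/-- With `H` the image and `T` the torsion subgroup, `[G : H] = [HT : H] [G : HT]`; the first factor
is `[T : H ∩ T]`, the second is the index of the image of `H` in `G / T`. -/
theorem index_range_twist {G : Type u} [CommGroup G] (φ : Monoid.End G) :
    (twist φ).range.index = (twist φ).range.relIndex (CommGroup.torsion G) *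
      (1 - freePartMap φ).range.toAddSubgroup.index := by
  rw [← map_range_twist]
  have h := Subgroup.index_map (twist φ).range (QuotientGroup.mk' (CommGroup.torsion G))
  rw [QuotientGroup.ker_mk', MonoidHom.range_eq_top_of_surjective _
    (QuotientGroup.mk'_surjective _), Subgroup.index_top, mul_one] at h
  have h2 : ((((twist φ).range.map (QuotientGroup.mk' (CommGroup.torsion G))).toAddSubgroup :
      AddSubgroup (FreePart G))).index =
      ((twist φ).range.map (QuotientGroup.mk' (CommGroup.torsion G))).index := rfl
  rw [h2, h, ← Subgroup.relIndex_sup_right (CommGroup.torsion G) (twist φ).range,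
    sup_comm (CommGroup.torsion G), Subgroup.relIndex_mul_index le_sup_left]

/-- If `x φ(x)⁻¹` is torsion, then `1 - freePartMap φ` kills the class of `x`, and injectivity makes
`x` itself torsion. -/
theorem relIndex_range_twist {G : Type u} [CommGroup G] (φ : Monoid.End G)
    (h : Function.Injective ⇑(1 - freePartMap φ)) :
    (twist φ).range.relIndex (CommGroup.torsion G) = (twist (torsionMap φ)).range.index := by
  unfold Subgroup.relIndex
  congr 1
  ext t
  rw [Subgroup.mem_subgroupOf]
  constructor
  · rintro ⟨x, hx⟩
    have hx0 : (1 - freePartMap φ) (freePartMk G (Additive.ofMul x)) = 0 := by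
      rw [← (freePartMk_eq_zero_iff _).2 t.2, ← hx]
      rfl
    have hx1 : x ∈ CommGroup.torsion G :=
      (freePartMk_eq_zero_iff x).1 (h (hx0.trans (map_zero _).symm))
    exact ⟨⟨x, hx1⟩, Subtype.ext hx⟩
  · rintro ⟨s, rfl⟩
    exact ⟨s, rfl⟩

theorem card_monoidHom_circle (Q : Type*) [CommGroup Q] [Finite Q] :
    Nat.card (Q →* Circle) = Nat.card Q := by
  have := Fintype.ofFinite (Additive Q)
  have e : (Q →* Circle) ≃ AddChar (Additive Q) ℂ :=
    (AddChar.toMonoidHomEquiv (A := Additive Q) (M := Circle)).symm.trans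
      AddChar.circleEquivComplex.toEquiv
  rw [Nat.card_congr e, Nat.card_eq_fintype_card, AddChar.card_eq, ← Nat.card_eq_fintype_card]
  rfl

/-- The fixed points of the dual of an endomorphism of a finite group are the characters of
the group of coinvariants. -/
theorem card_fixed_dualMap {T : Type u} [CommGroup T] [Finite T] [TopologicalSpace T]
    [DiscreteTopology T] (φ : Monoid.End T) :
    Nat.card {ψ : PontryaginDual T // dualMap φ ψ = ψ} = (twist φ).range.index := by
  rw [Subgroup.index, ← card_monoidHom_circle (T ⧸ (twist φ).range)]
  refine Nat.card_congr ⟨fun ψ => QuotientGroup.lift _ (ψ.1 : T →ₜ* Circle).toMonoidHom ?_,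
    fun χ => ⟨(⟨χ.comp (QuotientGroup.mk' _), continuous_of_discreteTopology⟩ : T →ₜ* Circle),
      ?_⟩, fun ψ => ?_, fun χ => ?_⟩
  · rintro _ ⟨x, rfl⟩
    have h : ψ.1 (φ x) = ψ.1 x := congrArg (fun χ : PontryaginDual T => χ x) ψ.2
    change ψ.1 (x / φ x) = 1
    rw [map_div, h, div_self']
  · refine PontryaginDual.ext fun x => ?_
    change χ (QuotientGroup.mk (φ x)) = χ (QuotientGroup.mk x)
    refine congrArg χ (QuotientGroup.eq.2 ⟨x, ?_⟩)
    rw [twist_apply, div_eq_mul_inv, mul_comm]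
  · exact Subtype.ext (PontryaginDual.ext fun x => rfl)
  · ext x
    rfl

variable {G : Type u} [CommGroup G] [Group.FG G] [TopologicalSpace G] [DiscreteTopology G]

theorem det_one_sub_freePartMap_ne_zero {G : Type u} [CommGroup G] [Group.FG G]
    (φ : Monoid.End G) (h : reidemeisterNumber φ ≠ ⊤) :
    LinearMap.det (1 - freePartMap φ) ≠ 0 := by
  rw [reidemeisterNumber_ne_top_iff, index_range_twist] at h
  exact det_ne_zero_of_index_range_ne_zero _ (right_ne_zero_of_mul h)

theorem toNat_reidemeisterNumber_eq_mul (φ : Monoid.End G)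
    (h : LinearMap.det (1 - freePartMap φ) ≠ 0) :
    (reidemeisterNumber φ).toNat =
      Nat.card {ψ : PontryaginDual (CommGroup.torsion G) // dualMap (torsionMap φ) ψ = ψ} *
        (LinearMap.det (1 - freePartMap φ)).natAbs := by
  have hi : Function.Injective ⇑(1 - freePartMap φ) := by
    rw [Ne, LinearMap.det_eq_zero_iff_ker_ne_bot, not_not] at h
    exact LinearMap.ker_eq_bot.1 h
  have := finite_torsion G
  rw [toNat_reidemeisterNumber, index_range_twist, relIndex_range_twist φ hi,
    index_range_eq_natAbs_det _ hi, card_fixed_dualMap]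

/-- `R(φ) = |L(φ̂)|`. -/
theorem toNat_reidemeisterNumber_eq_abs (φ : Monoid.End G) (h : reidemeisterNumber φ ≠ ⊤) :
    ((reidemeisterNumber φ).toNat : ℚ) = |lefschetzNumber (dualMap φ)| := by
  rw [toNat_reidemeisterNumber_eq_mul φ (det_one_sub_freePartMap_ne_zero φ h),
    lefschetzNumber_dualMap,
    abs_mul, Nat.abs_cast, Nat.cast_mul, Nat.cast_natAbs, Int.cast_abs]

theorem freePartMap_pow {G : Type u} [CommGroup G] (φ : Monoid.End G) (n : ℕ) :
    freePartMap (φ ^ n) = freePartMap φ ^ n := by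
  induction n with
  | zero =>
    refine LinearMap.ext fun x => ?_
    obtain ⟨x, rfl⟩ := freePartMk_surjective G x
    rfl
  | succ n ih =>
    rw [pow_succ, pow_succ, ← ih]
    refine LinearMap.ext fun x => ?_
    obtain ⟨x, rfl⟩ := freePartMk_surjective G x
    rfl

/-- The torsion-free quotient is trivial, so the determinant is `1` and no absolute value is needed.
-/
theorem reidemeisterNumber_of_finite [Finite G] (φ : Monoid.End G) :
    reidemeisterNumber φ ≠ ⊤ ∧
      ((reidemeisterNumber φ).toNat : ℚ) = lefschetzNumber (dualMap φ) := by
  have h : reidemeisterNumber φ ≠ ⊤ := by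
    rw [reidemeisterNumber_eq, Ne, ENat.card_eq_top, not_infinite_iff_finite]
    infer_instance
  have : Subsingleton (FreePart G) := by
    refine subsingleton_of_forall_eq 0 fun x => ?_
    obtain ⟨x, rfl⟩ := freePartMk_surjective G x
    exact (freePartMk_eq_zero_iff x.toMul).2 (isOfFinOrder_of_finite _)
  refine ⟨h, ?_⟩
  rw [toNat_reidemeisterNumber_eq_mul φ (det_one_sub_freePartMap_ne_zero φ h),
    lefschetzNumber_dualMap,
    LinearMap.det_eq_one_of_subsingleton]
  simp

end Index

/-! ### The sign of `det (1 - Aⁿ)` -/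

section Sign

open Polynomial

theorem det_one_sub_pow_eq_prod_roots {ι : Type*} [Fintype ι] [DecidableEq ι] (A : Matrix ι ι ℂ)
    (n : ℕ) : (1 - A ^ n).det = (A.charpoly.roots.map fun x => 1 - x ^ n).prod := by
  obtain ⟨X, T, Y, r, hXY, hA, hr, hT⟩ := exists_triangularization A
  have hYX := mul_eq_one_comm.1 hXY
  -- Ordering the indices through `r` turns block triangularity into upper triangularity.
  let _ : LinearOrder ι := LinearOrder.lift' r hr
  have hT' : T.IsUpperTriangular := fun i j hij => hT hij
  have hpow : A ^ n = X * T ^ n * Y := by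
    induction n with
    | zero => rw [pow_zero, pow_zero, mul_one, hXY]
    | succ n ih =>
      calc A ^ (n + 1) = X * T ^ n * (Y * X) * T * Y := by
            rw [pow_succ, ih, hA]; simp only [mul_assoc]
        _ = _ := by rw [hYX, mul_one, mul_assoc X, ← pow_succ]
  have hdet : (1 - A ^ n).det = (1 - T ^ n).det := by
    have h1 : 1 - A ^ n = X * (1 - T ^ n) * Y := by
      rw [hpow, mul_sub, sub_mul, mul_one, hXY]
    rw [h1, Matrix.det_mul_right_comm, hXY, one_mul]
  have hchar : A.charpoly = T.charpoly := by
    rw [hA, mul_assoc, Matrix.charpoly_mul_comm, mul_assoc, hYX, mul_one]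
  have hdiag : ∀ m i, (T ^ m) i i = T i i ^ m := by
    intro m i
    induction m with
    | zero => simp
    | succ m ih =>
      rw [pow_succ, pow_succ, ← ih, Matrix.mul_apply, Finset.sum_eq_single i]
      · intro j _ hj
        rcases lt_or_gt_of_ne hj with h | h
        · rw [hT'.pow m h, zero_mul]
        · rw [hT' h, mul_zero]
      · intro h
        exact absurd (Finset.mem_univ i) h
  obtain ⟨t, ht⟩ : ∃ t : ι → ℂ, ∀ i, T i i = t i := ⟨fun i => T i i, fun _ => rfl⟩
  have hroots : T.charpoly.roots = Finset.univ.val.map t := by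
    rw [Matrix.charpoly_of_isUpperTriangular _ hT', ← roots_multiset_prod_X_sub_C
      (Finset.univ.val.map t), Multiset.map_map]
    simp only [ht]
    rfl
  have hT1 : (1 - T ^ n).IsUpperTriangular :=
    Matrix.BlockTriangular.sub Matrix.blockTriangular_one (hT'.pow n)
  rw [hdet, hchar, hroots, Matrix.det_of_isUpperTriangular hT1, Multiset.map_map]
  refine Finset.prod_congr rfl fun i _ => ?_
  rw [Matrix.sub_apply, Matrix.one_apply_eq, hdiag, ht]
  rfl

/-- The non-real roots of a real polynomial contribute a non-negative factor. -/
theorem exists_prod_roots_eq (n : ℕ) (p : ℝ[X]) (hp : p.Monic) :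
    ∃ c : ℝ, 0 ≤ c ∧ ((p.map Complex.ofRealHom).roots.map fun x => 1 - x ^ n).prod =
      ((c * (p.roots.map fun x => 1 - x ^ n).prod : ℝ) : ℂ) := by
  induction h : p.natDegree using Nat.strong_induction_on generalizing p with
  | _ d ih =>
    subst h
    by_cases h0 : p.natDegree = 0
    · rw [eq_one_of_monic_natDegree_zero hp h0]
      exact ⟨1, zero_le_one, by simp⟩
    obtain ⟨z, hz⟩ := IsAlgClosed.exists_aeval_eq_zero ℂ p
      (fun h => h0 (natDegree_eq_of_degree_eq_some h))
    by_cases him : z.im = 0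
    · obtain ⟨x, rfl⟩ : ∃ x : ℝ, (x : ℂ) = z := ⟨z.re, Complex.ext rfl him.symm⟩
      have hx : p.IsRoot x := by
        rw [← Complex.coe_algebraMap, aeval_algebraMap_apply] at hz
        simpa using hz
      obtain ⟨q, rfl⟩ := dvd_iff_isRoot.2 hx
      have hq : q.Monic := (monic_X_sub_C x).of_mul_monic_left hp
      obtain ⟨c, hc, hcq⟩ := ih q.natDegree (by
        rw [(monic_X_sub_C x).natDegree_mul hq, natDegree_X_sub_C]; omega) q hq rfl
      refine ⟨c, hc, ?_⟩
      rw [Polynomial.map_mul, roots_mul hp.ne_zero, roots_mul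
        ((mul_ne_zero (by simpa using X_sub_C_ne_zero (x : ℂ)) (hq.map _).ne_zero)),
        Polynomial.map_sub, map_X, map_C, roots_X_sub_C, roots_X_sub_C, Multiset.map_add,
        Multiset.map_add, Multiset.prod_add, Multiset.prod_add, hcq]
      simp
      ring
    · obtain ⟨q, hq⟩ := p.quadratic_dvd_of_aeval_eq_zero_im_ne_zero hz him
      -- The real quadratic with roots `z` and its conjugate; this pair contributes `|1 - zⁿ|²` to
      -- the product over complex roots and nothing to the product over real roots.
      set s : ℝ[X] := X ^ 2 - C (2 * z.re) * X + C (‖z‖ ^ 2) with hs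
      have hsm : s.Monic := by
        rw [hs]; monicity!
      have hsd : s.natDegree = 2 := by
        rw [hs]; compute_degree!
      have hsC : s.map Complex.ofRealHom = (X - C z) * (X - C (starRingEnd ℂ z)) := by
        have h1 : C (z + starRingEnd ℂ z) = C ((2 * z.re : ℝ) : ℂ) := by rw [Complex.add_conj]
        have h2 : C (z * starRingEnd ℂ z) = C ((‖z‖ ^ 2 : ℝ) : ℂ) := by
          rw [Complex.mul_conj, Complex.normSq_eq_norm_sq]
        have h3 : s.map Complex.ofRealHom =
            X ^ 2 - C ((2 * z.re : ℝ) : ℂ) * X + C ((‖z‖ ^ 2 : ℝ) : ℂ) := by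
          simp [hs]
        rw [h3, ← h1, ← h2, C_add, C_mul]
        ring
      have hsr : s.roots = 0 := by
        refine Multiset.eq_zero_of_forall_notMem fun x hx => ?_
        have hx0 : (s.map Complex.ofRealHom).eval (x : ℂ) = 0 := by
          have := (mem_roots'.1 hx).2
          rw [← Complex.ofRealHom_eq_coe, eval_map_apply, this.eq_zero, map_zero]
        rw [hsC, eval_mul, mul_eq_zero] at hx0
        simp only [eval_sub, eval_X, eval_C, sub_eq_zero] at hx0
        rcases hx0 with h | h
        · exact him (by rw [← h, Complex.ofReal_im])
        · have := congrArg Complex.im h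
          rw [Complex.ofReal_im, Complex.conj_im] at this
          exact him (by linarith)
      subst hq
      have hqm : q.Monic := hsm.of_mul_monic_left hp
      obtain ⟨c, hc, hcq⟩ := ih q.natDegree (by
        rw [hsm.natDegree_mul hqm, hsd]; omega) q hqm rfl
      refine ⟨Complex.normSq (1 - z ^ n) * c, mul_nonneg (Complex.normSq_nonneg _) hc, ?_⟩
      rw [Polynomial.map_mul, roots_mul hp.ne_zero, hsr, zero_add,
        roots_mul (mul_ne_zero (hsm.map _).ne_zero (hqm.map _).ne_zero), hsC,
        roots_mul (mul_ne_zero (X_sub_C_ne_zero _) (X_sub_C_ne_zero _)), roots_X_sub_C,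
        roots_X_sub_C, Multiset.map_add, Multiset.map_add, Multiset.prod_add, Multiset.prod_add,
        hcq, Complex.ofReal_mul, Complex.ofReal_mul, Complex.ofReal_mul, ← Complex.mul_conj]
      simp
      ring

open scoped Classical in
-- The factor `1 - aⁿ` has sign `+` for `|a| < 1`, `-` for `a > 1`, and `-(-1)ⁿ` for `a < -1`.
theorem prod_one_sub_pow_sign (s : Multiset ℝ) (hs : ∀ x ∈ s, |x| ≠ 1) (n : ℕ) (hn : 1 ≤ n) :
    0 < (-1) ^ s.countP (fun x => 1 < |x|) * ((-1) ^ s.countP fun x => x < -1) ^ n *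
      (s.map fun x => 1 - x ^ n).prod := by
  induction s using Multiset.induction_on with
  | empty => simp
  | cons a s ih =>
    have ih := ih fun x hx => hs x (Multiset.mem_cons_of_mem hx)
    have ha := hs a (Multiset.mem_cons_self a s)
    rw [Multiset.map_cons, Multiset.prod_cons, Multiset.countP_cons, Multiset.countP_cons]
    set u : ℝ := (-1) ^ s.countP (fun x => 1 < |x|)
    set v : ℝ := (-1) ^ s.countP fun x => x < -1
    set w := (s.map fun x => 1 - x ^ n).prod
    have hn0 : n ≠ 0 := by omega
    suffices h : 0 < (-1) ^ (if 1 < |a| then 1 else 0) *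
        ((-1) ^ (if a < -1 then 1 else 0)) ^ n * (1 - a ^ n) by
      calc 0 < _ := mul_pos h ih
        _ = _ := by rw [pow_add, pow_add, mul_pow]; ring
    rcases lt_or_gt_of_ne ha with h | h
    · have h1 : ¬ a < -1 := not_lt.2 (abs_le.1 h.le).1
      have h2 : a ^ n < 1 := lt_of_le_of_lt (le_abs_self _) (by
        rw [abs_pow]; exact pow_lt_one₀ (abs_nonneg a) h hn0)
      rw [if_neg h.not_gt, if_neg h1]
      simpa using h2
    · rw [if_pos h]
      have h3 := one_lt_pow₀ h hn0
      by_cases h1 : a < -1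
      · rw [if_pos h1, pow_one]
        rw [abs_of_neg (by linarith), neg_pow] at h3
        rcases neg_one_pow_eq_or ℝ n with h4 | h4 <;> rw [h4] at h3 ⊢ <;> linarith
      · have h5 : 0 ≤ a := by
          by_contra! h6
          rw [abs_of_neg h6] at h
          exact h1 (by linarith)
        rw [if_neg h1, pow_zero, one_pow]
        rw [abs_of_nonneg h5] at h3
        linarith

end Sign

/-! ### Signs of determinants and Lefschetz numbers for powers of `φ` -/

section Sign

variable {G : Type u} [CommGroup G] [Group.FG G]

theorem exists_det_one_sub_pow_eq (φ : Monoid.End G) (n : ℕ) :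
    ∃ c : ℝ, 0 ≤ c ∧ ((LinearMap.det (1 - freePartMap φ ^ n) : ℤ) : ℝ) =
      c * ((realSpectrum φ).map fun x => 1 - x ^ n).prod := by
  obtain ⟨c, hc, h⟩ := exists_prod_roots_eq n
    ((freePartMap φ).charpoly.map (Int.castRingHom ℝ)) ((freePartMap φ).charpoly_monic.map _)
  refine ⟨c, hc, Complex.ofReal_injective (Eq.trans ?_ h)⟩
  let b := Module.Free.chooseBasis ℤ (FreePart G)
  set A := LinearMap.toMatrix b b (freePartMap φ) with hA
  have h1 : (Polynomial.map Complex.ofRealHom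
      ((freePartMap φ).charpoly.map (Int.castRingHom ℝ))) =
      ((Int.castRingHom ℂ).mapMatrix A).charpoly := by
    rw [Polynomial.map_map, ← LinearMap.charpoly_toMatrix (freePartMap φ) b]
    refine Eq.trans ?_ (Matrix.charpoly_map A (Int.castRingHom ℂ)).symm
    congr 1
  have h2 : LinearMap.det (1 - freePartMap φ ^ n) = (1 - A ^ n).det := by
    rw [← LinearMap.det_toMatrix b, map_sub, LinearMap.toMatrix_one, ← LinearMap.toMatrix_pow]
  have h3 : 1 - (Int.castRingHom ℂ).mapMatrix A ^ n =
      (Int.castRingHom ℂ).mapMatrix (1 - A ^ n) := by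
    rw [map_sub, map_one, map_pow]
  rw [h1, ← det_one_sub_pow_eq_prod_roots, h2, h3, ← RingHom.map_det]
  simp

/-- The second power suffices, since `1 - x²` vanishes at both `1` and `-1`. -/
theorem abs_ne_one_of_mem_realSpectrum (φ : Monoid.End G)
    (h : LinearMap.det (1 - freePartMap φ ^ 2) ≠ 0) (x : ℝ) (hx : x ∈ realSpectrum φ) :
    |x| ≠ 1 := by
  intro h1
  obtain ⟨c, -, hc⟩ := exists_det_one_sub_pow_eq φ 2
  rw [Multiset.prod_eq_zero, mul_zero] at hc
  · exact h (by exact_mod_cast hc)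
  · exact Multiset.mem_map.2 ⟨x, hx, by rw [← sq_abs, h1]; norm_num⟩

theorem natAbs_det_one_sub_pow (φ : Monoid.End G)
    (h : ∀ n : ℕ, 1 ≤ n → LinearMap.det (1 - freePartMap φ ^ n) ≠ 0) (n : ℕ) (hn : 1 ≤ n) :
    (((LinearMap.det (1 - freePartMap φ ^ n)).natAbs : ℕ) : ℚ) =
      (-1) ^ numAbsGtOne φ * sigma φ ^ n *
        ((LinearMap.det (1 - freePartMap φ ^ n) : ℤ) : ℚ) := by
  obtain ⟨c, hc, hdet⟩ := exists_det_one_sub_pow_eq φ n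
  have hs := prod_one_sub_pow_sign (realSpectrum φ)
    (abs_ne_one_of_mem_realSpectrum φ (h 2 one_le_two)) n hn
  have h0 : 0 ≤ (-1) ^ numAbsGtOne φ * ((-1) ^ numLtNegOne φ) ^ n *
      LinearMap.det (1 - freePartMap φ ^ n) := by
    have : 0 ≤ (-1) ^ numAbsGtOne φ * ((-1) ^ numLtNegOne φ) ^ n *
        ((LinearMap.det (1 - freePartMap φ ^ n) : ℤ) : ℝ) := by
      rw [hdet, mul_left_comm]
      exact mul_nonneg hc hs.le
    exact_mod_cast this
  have h1 : (((LinearMap.det (1 - freePartMap φ ^ n)).natAbs : ℕ) : ℤ) =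
      (-1) ^ numAbsGtOne φ * ((-1) ^ numLtNegOne φ) ^ n *
        LinearMap.det (1 - freePartMap φ ^ n) := by
    rw [← abs_of_nonneg h0, abs_mul, abs_mul, abs_pow, abs_pow, abs_pow, Int.natCast_natAbs]
    simp
  rw [sigma, ← Int.cast_natCast, h1]
  push_cast
  rfl

theorem toNat_reidemeisterNumber_pow [TopologicalSpace G] [DiscreteTopology G]
    (φ : Monoid.End G) (h : ∀ n : ℕ, 1 ≤ n → reidemeisterNumber (φ ^ n) ≠ ⊤) (n : ℕ)
    (hn : 1 ≤ n) :
    ((reidemeisterNumber (φ ^ n)).toNat : ℚ) =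
      (-1) ^ numAbsGtOne φ * sigma φ ^ n * lefschetzNumber (dualMap (φ ^ n)) := by
  have hd : ∀ n : ℕ, 1 ≤ n → LinearMap.det (1 - freePartMap φ ^ n) ≠ 0 := fun n hn => by
    rw [← freePartMap_pow]
    exact det_one_sub_freePartMap_ne_zero _ (h n hn)
  rw [toNat_reidemeisterNumber_eq_mul _ (det_one_sub_freePartMap_ne_zero _ (h n hn)),
    lefschetzNumber_dualMap, Nat.cast_mul, freePartMap_pow, natAbs_det_one_sub_pow φ hd n hn]
  ring

end Sign

/-! ### Zeta functions -/

section Zeta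

open PowerSeries

theorem zetaSeries_congr {a b : ℕ → ℚ} (h : ∀ n, 1 ≤ n → a n = b n) :
    zetaSeries a = zetaSeries b := by
  unfold zetaSeries
  congr 1
  ext n
  rw [coeff_mk, coeff_mk]
  split_ifs with hn
  · rfl
  · rw [h n (Nat.one_le_iff_ne_zero.2 hn)]

/-- Substitute `f` into the identity `exp(X) exp(-X) = 1`. -/
theorem exp_subst_neg (f : PowerSeries ℚ) (hf : constantCoeff f = 0) :
    (exp ℚ).subst (-f) = ((exp ℚ).subst f)⁻¹ := by
  have hs := HasSubst.of_constantCoeff_zero' hf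
  have h1 : (exp ℚ).subst (-f) = (evalNegHom (exp ℚ)).subst f := by
    have h2 : HasSubst ((-1 : ℚ) • (X : PowerSeries ℚ)) :=
      HasSubst.of_constantCoeff_zero' (by simp)
    rw [evalNegHom, rescale_eq_subst, subst_comp_subst_apply h2 hs, subst_smul hs, subst_X hs,
      neg_one_smul]
  have h2 : (exp ℚ).subst f * (exp ℚ).subst (-f) = 1 := by
    rw [h1, ← subst_mul hs, exp_mul_exp_neg_eq_one, ← coe_substAlgHom hs, map_one]
  have h3 : constantCoeff ((exp ℚ).subst f) ≠ 0 := fun h => by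
    have := congrArg constantCoeff h2
    rw [map_mul, h, zero_mul, map_one] at this
    exact zero_ne_one this
  rw [PowerSeries.eq_inv_iff_mul_eq_one h3, mul_comm, h2]

/-- Inside the exponential, the factor `σ ^ n` rescales the variable, and the global sign `(-1) ^ r`
decides between the series and its inverse. -/
theorem zetaSeries_twist (a : ℕ → ℚ) (σ : ℚ) (r : ℕ) :
    zetaSeries (fun n => (-1) ^ r * σ ^ n * a n) = signPow (rescale σ (zetaSeries a)) r := by
  set f : PowerSeries ℚ := PowerSeries.mk fun n => if n = 0 then 0 else a n / n
  have hf : constantCoeff f = 0 := by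
    rw [← coeff_zero_eq_constantCoeff_apply, coeff_mk, if_pos rfl]
  have hσ : rescale σ (zetaSeries a) = (exp ℚ).subst (rescale σ f) := by
    have h2 : HasSubst (σ • (X : PowerSeries ℚ)) :=
      HasSubst.of_constantCoeff_zero' (by simp)
    rw [rescale_eq_subst, rescale_eq_subst, zetaSeries,
      subst_comp_subst_apply (HasSubst.of_constantCoeff_zero' hf) h2]
  have hσ0 : constantCoeff (rescale σ f) = 0 := by
    rw [← coeff_zero_eq_constantCoeff_apply, coeff_rescale, coeff_zero_eq_constantCoeff_apply, hf,
      mul_zero]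
  have h : (PowerSeries.mk fun n => if n = 0 then 0 else (-1) ^ r * σ ^ n * a n / n) =
      (-1 : ℚ) ^ r • rescale σ f := by
    ext n
    rw [coeff_mk, coeff_smul, coeff_rescale, coeff_mk]
    split_ifs
    · simp
    · rw [smul_eq_mul, mul_div_assoc, mul_assoc]
  rw [zetaSeries, h, hσ, signPow]
  split_ifs with hr
  · rw [hr.neg_one_pow, one_smul]
  · rw [(Nat.not_even_iff_odd.1 hr).neg_one_pow, neg_one_smul, exp_subst_neg _ hσ0]

end Zeta

end Reidemeister

end

theorem theorem13 {G : Type u} [CommGroup G] [Group.FG G]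
    [TopologicalSpace G] [DiscreteTopology G] (φ : Monoid.End G) :
    -- the Lefschetz numbers of self-maps of the dual are well defined, as finite sums of traces
    (∀ k : ℕ, Module.Finite ℚ (Reidemeister.rationalHomology k (PontryaginDual G))) ∧
    (∀ k : ℕ, Module.finrank ℤ (Reidemeister.FreePart G) < k →
      Subsingleton (Reidemeister.rationalHomology k (PontryaginDual G))) ∧
    -- `R(φⁿ) = |L(φ̂ⁿ)|`
    (∀ n : ℕ, 1 ≤ n → Reidemeister.reidemeisterNumber (φ ^ n) ≠ ⊤ →
      ((Reidemeister.reidemeisterNumber (φ ^ n)).toNat : ℚ) =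
        |Reidemeister.lefschetzNumber
          (Reidemeister.iterateMap (Reidemeister.dualMap φ) n)|) ∧
    -- `R_φ(z) = L_φ̂(σ z) ^ ((-1) ^ r)`
    ((∀ n : ℕ, 1 ≤ n → Reidemeister.reidemeisterNumber (φ ^ n) ≠ ⊤) →
      Reidemeister.reidemeisterZeta φ =
        Reidemeister.signPow
          (PowerSeries.rescale (Reidemeister.sigma φ)
            (Reidemeister.lefschetzZeta (Reidemeister.dualMap φ)))
          (Reidemeister.numAbsGtOne φ)) ∧
    -- the case of a finite group
    (Finite G →
      (∀ n : ℕ, 1 ≤ n →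
        Reidemeister.reidemeisterNumber (φ ^ n) ≠ ⊤ ∧
        ((Reidemeister.reidemeisterNumber (φ ^ n)).toNat : ℚ) =
          Reidemeister.lefschetzNumber
            (Reidemeister.iterateMap (Reidemeister.dualMap φ) n)) ∧
      Reidemeister.reidemeisterZeta φ =
        Reidemeister.lefschetzZeta (Reidemeister.dualMap φ)) := by
  refine ⟨Reidemeister.finiteHomology_pontryaginDual.finite,
    Reidemeister.finiteHomology_pontryaginDual.subsingleton,
    fun n _ h => ?_, fun h => ?_, fun hG => ?_⟩
  · rw [Reidemeister.iterateMap_dualMap]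
    exact Reidemeister.toNat_reidemeisterNumber_eq_abs _ h
  · rw [Reidemeister.lefschetzZeta, ← Reidemeister.zetaSeries_twist]
    refine Reidemeister.zetaSeries_congr fun n hn => ?_
    rw [Reidemeister.iterateMap_dualMap]
    exact Reidemeister.toNat_reidemeisterNumber_pow φ h n hn
  · have h (n : ℕ) : Reidemeister.reidemeisterNumber (φ ^ n) ≠ ⊤ ∧
        ((Reidemeister.reidemeisterNumber (φ ^ n)).toNat : ℚ) =
          Reidemeister.lefschetzNumber
            (Reidemeister.iterateMap (Reidemeister.dualMap φ) n) := by
      rw [Reidemeister.iterateMap_dualMap]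
      exact Reidemeister.reidemeisterNumber_of_finite _
    exact ⟨fun n _ => h n, Reidemeister.zetaSeries_congr fun n _ => (h n).2⟩
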